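/- **Theorem 3.1.** Let $a\in\mathbb R\setminus\{0,1,-1\}$, $p\neq 0$ and $k=\left|\frac{a-1}{a+1}\right|$. For $q\in\mathbb R$ let $$H_q(v,(x_0,y_0,z_0))=(x_0\cos v-y_0\sin v,\;x_0\sin v+y_0\cos v,\;z_0+qv)$$ be the helical motion of pitch $q$ about the $z$-axis, and write $H=H_{1/2}$. For $C>0$ set $$h(s)=\frac{2Cs^{k+1}}{s^2+1},\qquad I_C=\{s>0:\ h(s)>1\},$$ $$g(s)=\frac{(k-1)s^2-(k+1)}{4ks}\sqrt{h(s)},\qquad t(s)=\sqrt{h(s)-1}\qquad(s\in I_C),$$ $$X_0(s)=\Bigl(\tfrac{t(s)}2,\,g(s),\,\int\tfrac{g'(s)}{t(s)}\,ds\Bigr),\qquad X_1(s)=\Bigl(-\tfrac{t(s)}2,\,g(s),\,-\int\tfrac{g'(s)}{t(s)}\,ds\Bigr),$$ where $\int\frac{g'}{t}\,ds$ is an antiderivative on $I_C$; its constant may be chosen separately for $X_0$ and $X_1$. A surface is said to have principal curvature ratio $a$ at a point if its principal curvatures there, in a suitable order, satisfy $\kappa_2\neq0$ and $\kappa_1/\kappa_2=a$.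 (i) Let $c$ be a $C^2$ curve on a nonempty open interval $J$ such that the helical surface $X(v,u)=H_p(v,c(u))$, $v\in\mathbb R$, $u\in J$, of pitch $p$ is regular and has principal curvature ratio $a$ at all its points. Then there is at most one $u_0\in J$ for which the tangent planes of $X$ along the helix $v\mapsto X(v,u_0)$ are parallel to the $z$-axis. Moreover there are a constant $C>0$ and a choice of the antiderivatives in $X_0,X_1$ such that, on $J\setminus\{u_0\}$ (on $J$ if there is no such $u_0$), there are an index $i(u)\in\{0,1\}$, constant on each component, and $C^1$ functions $\sigma,\varphi$ with $\sigma(u)\in I_C$, $\sigma'(u)\neq0$ and $$X(v,u)=2p\,H\bigl(v+\varphi(u),\,X_{i(u)}(\sigma(u))\bigr)\qquad\text{for all }v\in\mathbb R.$$ That is, off this one helix $X$ is, up to reparametrization, a part of the surfaces $2p\,H(v,X_i(s))$, $s\in I_C$, $i=0,1$. (ii) Conversely, for every $C>0$, every choice of the antiderivative and $i\in\{0,1\}$, the surface $2p\,H(v,X_i(s))$, $v\in\mathbb R$, $s\in I_C$, is regular and has principal curvature ratio $a$ at every $(v,s)$ with $(k-1)s^2+k+1\neq0$. -/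

import Mathlib

noncomputable section

namespace HelicalCRPC

/-- Euclidean 3-space with Cartesian coordinates `x = P 0`, `y = P 1`, `z = P 2`. -/
abbrev E3 : Type := EuclideanSpace ℝ (Fin 3)

/-- The helical motion of pitch `p` about the `z`-axis, at rotation angle `v`, applied to `P`. -/
def helicalMotion (p v : ℝ) (P : E3) : E3 :=
  !₂[P 0 * Real.cos v - P 1 * Real.sin v, P 0 * Real.sin v + P 1 * Real.cos v, P 2 + p * v]

/-- The helical surface of pitch `p` generated by the curve `c`, as a parametrized surface. -/
def helicalSurface (p : ℝ) (c : ℝ → E3) : ℝ → ℝ → E3 :=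
  fun v u => helicalMotion p v (c u)

/-! ### Curvature of parametrized surfaces in Euclidean 3-space -/

/-- Partial derivative in the first parameter. -/
def partialFst (Φ : ℝ → ℝ → E3) : ℝ → ℝ → E3 :=
  fun v u => deriv (fun x => Φ x u) v

/-- Partial derivative in the second parameter. -/
def partialSnd (Φ : ℝ → ℝ → E3) : ℝ → ℝ → E3 :=
  fun v u => deriv (fun y => Φ v y) u

/-- The parametrization is an immersion at `(v, u)`. -/
def IsRegularAt (Φ : ℝ → ℝ → E3) (v u : ℝ) : Prop :=
  LinearIndependent ℝ ![partialFst Φ v u, partialSnd Φ v u]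

/-- The tangent plane at `(v, u)`, as a linear subspace. -/
def tangentPlane (Φ : ℝ → ℝ → E3) (v u : ℝ) : Submodule ℝ E3 :=
  Submodule.span ℝ {partialFst Φ v u, partialSnd Φ v u}

/-- The cross product of the two partial derivatives. -/
def normalVector (Φ : ℝ → ℝ → E3) (v u : ℝ) : E3 :=
  WithLp.toLp 2
    (crossProduct (WithLp.ofLp (partialFst Φ v u)) (WithLp.ofLp (partialSnd Φ v u)))

/-- The unit normal (at regular points). -/
def unitNormal (Φ : ℝ → ℝ → E3) (v u : ℝ) : E3 :=
  ‖normalVector Φ v u‖⁻¹ • normalVector Φ v u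

/-- Matrix of the first fundamental form. -/
def firstForm (Φ : ℝ → ℝ → E3) (v u : ℝ) : Matrix (Fin 2) (Fin 2) ℝ :=
  !![inner ℝ (partialFst Φ v u) (partialFst Φ v u), inner ℝ (partialFst Φ v u) (partialSnd Φ v u);
     inner ℝ (partialFst Φ v u) (partialSnd Φ v u), inner ℝ (partialSnd Φ v u) (partialSnd Φ v u)]

/-- Matrix of the second fundamental form with respect to `unitNormal`. -/
def secondForm (Φ : ℝ → ℝ → E3) (v u : ℝ) : Matrix (Fin 2) (Fin 2) ℝ :=
  !![inner ℝ (unitNormal Φ v u) (partialFst (partialFst Φ) v u),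
       inner ℝ (unitNormal Φ v u) (partialFst (partialSnd Φ) v u);
     inner ℝ (unitNormal Φ v u) (partialFst (partialSnd Φ) v u),
       inner ℝ (unitNormal Φ v u) (partialSnd (partialSnd Φ) v u)]

/-- Matrix of the shape operator in the basis of partial derivatives. -/
def shapeMatrix (Φ : ℝ → ℝ → E3) (v u : ℝ) : Matrix (Fin 2) (Fin 2) ℝ :=
  (firstForm Φ v u)⁻¹ * secondForm Φ v u

/-- The principal curvatures at `(v, u)`: the eigenvalues of the shape operator, counted with
multiplicity. -/
def principalCurvatures (Φ : ℝ → ℝ → E3) (v u : ℝ) : Multiset ℝ :=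
  (shapeMatrix Φ v u).charpoly.roots

/-- At `(v, u)` the principal curvatures, in a suitable order, are `κ₁, κ₂` with `κ₁ / κ₂ = a`. -/
def HasCurvatureRatioAt (Φ : ℝ → ℝ → E3) (a v u : ℝ) : Prop :=
  ∃ κ₁ κ₂ : ℝ, principalCurvatures Φ v u = {κ₁, κ₂} ∧ κ₂ ≠ 0 ∧ κ₁ / κ₂ = a

/-! ### The explicit profile curves -/

/-- The parameter `k = |(a - 1) / (a + 1)|`. -/
def ratioParam (a : ℝ) : ℝ := |(a - 1) / (a + 1)|

/-- `h(s) = 2 C s ^ (k + 1) / (s² + 1)`. -/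
def hFun (k C s : ℝ) : ℝ := 2 * C * s ^ (k + 1) / (s ^ 2 + 1)

/-- The parameter domain `I_C = {s > 0 : h(s) > 1}`. -/
def domainI (k C : ℝ) : Set ℝ := {s | 0 < s ∧ 1 < hFun k C s}

/-- `g(s) = ((k - 1) s² - (k + 1)) / (4 k s) * √h(s)`. -/
def gFun (k C s : ℝ) : ℝ :=
  ((k - 1) * s ^ 2 - (k + 1)) / (4 * k * s) * Real.sqrt (hFun k C s)

/-- `t(s) = √(h(s) - 1)`. -/
def tFun (k C s : ℝ) : ℝ := Real.sqrt (hFun k C s - 1)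

/-- `Z` is an antiderivative `∫ g'(s) / t(s) ds` on `I_C`. -/
def IsHeight (k C : ℝ) (Z : ℝ → ℝ) : Prop :=
  ∀ s ∈ domainI k C, HasDerivAt Z (deriv (gFun k C) s / tFun k C s) s

/-- The profile curves `X₀ = (t / 2, g, Z)` and `X₁ = (-t / 2, g, -Z)`. -/
def profileCurve (k C : ℝ) (Z : ℝ → ℝ) (i : Fin 2) (s : ℝ) : E3 :=
  match i with
  | 0 => !₂[tFun k C s / 2, gFun k C s, Z s]
  | 1 => !₂[-(tFun k C s / 2), gFun k C s, -(Z s)]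

/-- The explicit surface `(v, s) ↦ 2 p H(v, X_i(s))`, with `H` the helical motion of pitch `1/2`. -/
def explicitSurface (p k C : ℝ) (Z : ℝ → ℝ) (i : Fin 2) : ℝ → ℝ → E3 :=
  fun v s => (2 * p) • helicalMotion (1 / 2) v (profileCurve k C Z i s)

/-- The parameters `u ∈ J` along whose helix the tangent planes of the helical surface are parallel
to the `z`-axis (the tangent planes along a helix are rotated copies of the one at `v = 0`). -/
def axialParams (p : ℝ) (c : ℝ → E3) (J : Set ℝ) : Set ℝ :=
  {u ∈ J | !₂[(0 : ℝ), 0, 1] ∈ tangentPlane (helicalSurface p c) 0 u}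

end HelicalCRPC

end

/-! After the homothety by `1 / p` the pitch is `1`. Helical motions about the `z`-axis move the
profile along the surface, so it may be replaced by a contour for the projection along the `x`-axis,
that is, by a curve `(x, y, z)` along which the normals are proportional to `(0, 1, -x)`. On a
contour `y' = x z'`, and the second fundamental form contains only first derivatives. Constancy of
the curvature ratio then becomes the equation of a conic for `η = y / √(1 + x²)` and
`δ = ((1 + x²) z' - y x') / (x' √(1 + x²))`. The parameter `s` comes from a rational
parametrization of this conic. Differentiating `η` shows that `(1 + x²) / h(s)` is locally constant
where `x ≠ 0`, which gives `1 + x² = h(s)` for a suitable `C`; hence `x = ±t(s)`, `y = 2 g(s)`, and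
`z` follows by integrating `z' = y' / x`. The tangent planes parallel to the `z`-axis are those at
`x = 0`, and `x` is injective because a nonzero curvature ratio forces `x' ≠ 0`. -/

noncomputable section

namespace HelicalCRPC

open Set Filter Topology
open scoped InnerProductSpace Matrix

section Calculus

variable {E : Type*} [NormedAddCommGroup E] [NormedSpace ℝ E]

theorem exists_hasDerivAt_of_continuousOn [CompleteSpace E] {J : Set ℝ} (hJ : IsOpen J)
    (hJc : J.OrdConnected) {f : ℝ → E} (hf : ContinuousOn f J) :
    ∃ F : ℝ → E, ∀ u ∈ J, HasDerivAt F (f u) u := by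
  rcases J.eq_empty_or_nonempty with rfl | ⟨u₀, hu₀⟩
  · exact ⟨0, fun u hu => hu.elim⟩
  · exact ⟨fun u => ∫ x in u₀..u, f x, fun u hu =>
      intervalIntegral.integral_hasDerivAt_right
        (hf.mono (hJc.uIcc_subset hu₀ hu)).intervalIntegrable
        (hf.stronglyMeasurableAtFilter hJ u hu) (hf.continuousAt (hJ.mem_nhds hu))⟩

theorem contDiffOn_succ_of_hasDerivAt {n : ℕ} {J : Set ℝ} (hJ : IsOpen J) {f f' : ℝ → E}
    (hf : ∀ u ∈ J, HasDerivAt f (f' u) u) (hf' : ContDiffOn ℝ n f' J) :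
    ContDiffOn ℝ (n + 1) f J :=
  (contDiffOn_succ_iff_deriv_of_isOpen hJ).2
    ⟨fun u hu => (hf u hu).differentiableAt.differentiableWithinAt, by simp,
      hf'.congr fun u hu => (hf u hu).deriv⟩

theorem eq_of_hasDerivAt_zero_off_countable [CompleteSpace E] {J S : Set ℝ}
    (hJ : J.OrdConnected) (hS : S.Countable) {f : ℝ → E} (hf : ContinuousOn f J)
    (hf' : ∀ u ∈ J \ S, HasDerivAt f 0 u) {x y : ℝ} (hx : x ∈ J) (hy : y ∈ J) : f x = f y := by
  have hsub : uIcc x y ⊆ J := hJ.uIcc_subset hx hy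
  have h := MeasureTheory.integral_eq_of_hasDerivAt_off_countable f 0 hS (hf.mono hsub)
    (fun u hu => hf' u ⟨hsub (Ioo_subset_Icc_self hu.1), hu.2⟩)
    (intervalIntegrable_const (c := (0 : E)))
  simpa only [Pi.zero_apply, intervalIntegral.integral_zero, eq_comm, sub_eq_zero] using h

theorem exists_contDiffOn_exp_eq {J : Set ℝ} (hJ : IsOpen J) (hJc : J.OrdConnected) {f : ℝ → ℂ}
    (hf : ContDiffOn ℝ 1 f J) (hf0 : ∀ u ∈ J, f u ≠ 0) :
    ∃ θ : ℝ → ℂ, ContDiffOn ℝ 1 θ J ∧ ∀ u ∈ J, Complex.exp (θ u) = f u := by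
  rcases J.eq_empty_or_nonempty with rfl | ⟨u₀, hu₀⟩
  · exact ⟨0, contDiffOn_const, fun u hu => hu.elim⟩
  have hdf : ∀ u ∈ J, HasDerivAt f (deriv f u) u := fun u hu =>
    ((hf.contDiffAt (hJ.mem_nhds hu)).differentiableAt one_ne_zero).hasDerivAt
  have hquot : ContinuousOn (fun u => deriv f u / f u) J :=
    (hf.continuousOn_deriv_of_isOpen hJ le_rfl).div hf.continuousOn hf0
  obtain ⟨F, hF⟩ := exists_hasDerivAt_of_continuousOn hJ hJc hquot
  have hprod : ∀ u ∈ J, HasDerivAt (fun u => f u * Complex.exp (-F u)) 0 u := fun u hu => by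
    refine ((hdf u hu).mul (hF u hu).fun_neg.cexp).congr_deriv ?_
    field_simp [hf0 u hu]
    ring
  have hconst : ∀ u ∈ J, f u * Complex.exp (-F u) = f u₀ * Complex.exp (-F u₀) := fun u hu =>
    eq_of_hasDerivAt_zero_off_countable hJc countable_empty
      (fun x hx => (hprod x hx).continuousAt.continuousWithinAt)
      (fun x hx => hprod x hx.1) hu hu₀
  refine ⟨fun u => Complex.log (f u₀) - F u₀ + F u,
    contDiffOn_const.add
      (contDiffOn_succ_of_hasDerivAt (n := 0) hJ hF (contDiffOn_zero.2 hquot)), fun u hu => ?_⟩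
  rw [Complex.exp_add, sub_eq_add_neg, Complex.exp_add, Complex.exp_log (hf0 u₀ hu₀),
    ← hconst u hu, mul_assoc, ← Complex.exp_add, neg_add_cancel, Complex.exp_zero, mul_one]

theorem contDiffAt_of_comp_eventuallyEq {n : WithTop ℕ∞} (hn : n ≠ 0) {f s η : ℝ → ℝ} {u : ℝ}
    (hf : ContDiffAt ℝ n f (s u)) (hf' : deriv f (s u) ≠ 0) (hs : ContinuousAt s u)
    (hη : ContDiffAt ℝ n η u) (h : f ∘ s =ᶠ[𝓝 u] η) : ContDiffAt ℝ n s u := by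
  have hd : HasFDerivAt f
      (ContinuousLinearEquiv.unitsEquivAut ℝ (Units.mk0 _ hf') : ℝ →L[ℝ] ℝ) (s u) :=
    (hf.differentiableAt hn).hasDerivAt.hasFDerivAt_equiv hf'
  have hinv : ContDiffAt ℝ n (hf.localInverse hd hn) (η u) :=
    h.self_of_nhds ▸ hf.to_localInverse hd hn
  refine (hinv.comp u hη).congr_of_eventuallyEq ?_
  filter_upwards [h, hs.eventually (hf.hasStrictFDerivAt' hd hn).eventually_left_inverse]
    with x hx hleft
  rw [Function.comp_apply, ← hx]
  exact hleft.symm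

theorem ordConnected_inter_preimage {J T : Set ℝ} (hJ : J.OrdConnected) (hT : T.OrdConnected)
    {f : ℝ → ℝ} (hf : ContinuousOn f J) (hinj : InjOn f J) : (J ∩ f ⁻¹' T).OrdConnected := by
  refine ⟨fun x hx y hy z hz => ?_⟩
  have hsub : Icc x y ⊆ J := hJ.out hx.1 hy.1
  have hxy : x ≤ y := hz.1.trans hz.2
  have hxm : x ∈ Icc x y := left_mem_Icc.2 hxy
  have hym : y ∈ Icc x y := right_mem_Icc.2 hxy
  refine ⟨hsub hz, hT.uIcc_subset hx.2 hy.2 ?_⟩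
  rcases (hf.mono hsub).strictMonoOn_of_injOn_Icc' hxy (hinj.mono hsub) with h | h
  · exact Icc_subset_uIcc ⟨h.monotoneOn hxm hz hz.1, h.monotoneOn hz hym hz.2⟩
  · exact Icc_subset_uIcc' ⟨h.antitoneOn hz hym hz.2, h.antitoneOn hxm hz hz.1⟩

theorem forall_pos_or_forall_neg {X : Type*} [TopologicalSpace X] {S : Set X}
    (hS : IsPreconnected S) {f : X → ℝ} (hf : ContinuousOn f S) (h0 : ∀ x ∈ S, f x ≠ 0) :
    (∀ x ∈ S, 0 < f x) ∨ ∀ x ∈ S, f x < 0 := by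
  by_contra! h
  obtain ⟨⟨x, hx, hfx⟩, y, hy, hfy⟩ := h
  obtain ⟨z, hz, hfz⟩ := (hS.image f hf).ordConnected.out (mem_image_of_mem f hx)
    (mem_image_of_mem f hy) ⟨hfx, hfy⟩
  exact h0 z hz hfz

theorem injOn_of_deriv_ne_zero {J : Set ℝ} {f : ℝ → ℝ} (hJ : J.OrdConnected)
    (hf : ∀ u ∈ J, deriv f u ≠ 0) : InjOn f J := by
  have hlt : ∀ x ∈ J, ∀ y ∈ J, x < y → f x ≠ f y := fun x hx y hy hxy heq => by
    have hsub := hJ.out hx hy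
    obtain ⟨t, ht, ht0⟩ := exists_deriv_eq_zero hxy (fun t ht =>
      (differentiableAt_of_deriv_ne_zero (hf t (hsub ht))).continuousAt.continuousWithinAt) heq
    exact hf t (hsub (Ioo_subset_Icc_self ht)) ht0
  intro x hx y hy heq
  by_contra hne
  rcases lt_or_gt_of_ne hne with h | h
  exacts [hlt x hx y hy h heq, hlt y hy x hx h heq.symm]

end Calculus

section EigenvalueRatio

theorem charpoly_roots_eq_pair_iff {R : Type*} [CommRing R] [IsDomain R]
    (S : Matrix (Fin 2) (Fin 2) R) (x y : R) :
    S.charpoly.roots = {x, y} ↔ S.trace = x + y ∧ S.det = x * y := by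
  have h := Polynomial.roots_quadratic_eq_pair_iff_of_ne_zero (one_ne_zero (α := R))
    (b := -S.trace) (c := S.det) (x1 := x) (x2 := y)
  rw [Polynomial.C_1, one_mul, Polynomial.C_neg, neg_mul, ← sub_eq_add_neg] at h
  rw [Matrix.charpoly_fin_two, h, neg_mul, neg_inj, one_mul, one_mul]

variable {K : Type*} [Field K]

theorem exists_charpoly_roots_ratio_iff {a : K} (ha : a ≠ -1)
    (S : Matrix (Fin 2) (Fin 2) K) :
    (∃ x y : K, S.charpoly.roots = {x, y} ∧ y ≠ 0 ∧ x / y = a) ↔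
      S.trace ≠ 0 ∧ (1 + a) ^ 2 * S.det = a * S.trace ^ 2 := by
  have ha' : 1 + a ≠ 0 := fun h => ha (by linear_combination h)
  simp only [charpoly_roots_eq_pair_iff]
  constructor
  · rintro ⟨x, y, ⟨htr, hdet⟩, hy, rfl⟩
    rw [htr, hdet]
    refine ⟨fun h => ha' ?_, by field_simp; ring⟩
    rw [one_add_div hy, add_comm, h, zero_div]
  · rintro ⟨htr, hdet⟩
    refine ⟨a * (S.trace / (1 + a)), S.trace / (1 + a), ⟨by field_simp; ring, ?_⟩,
      div_ne_zero htr ha', by field_simp⟩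
    field_simp
    linear_combination hdet

theorem trace_inv_mul_fin_two (E F G L M N : K) :
    (!![E, F; F, G]⁻¹ * !![L, M; M, N]).trace = (E * N - 2 * F * M + G * L) / (E * G - F ^ 2) := by
  rw [Matrix.inv_def, Matrix.adjugate_fin_two_of, Matrix.det_fin_two_of, Ring.inverse_eq_inv',
    Matrix.smul_mul, Matrix.trace_smul, Matrix.trace_fin_two, smul_eq_mul, div_eq_inv_mul,
    ← sq]
  congr 1
  simp only [Matrix.mul_apply, Fin.sum_univ_two, Matrix.of_apply, Matrix.cons_val_zero,
    Matrix.cons_val_one]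
  ring

theorem det_inv_mul_fin_two (E F G L M N : K) :
    (!![E, F; F, G]⁻¹ * !![L, M; M, N]).det = (L * N - M ^ 2) / (E * G - F ^ 2) := by
  rw [Matrix.det_mul, Matrix.det_nonsing_inv, Ring.inverse_eq_inv', Matrix.det_fin_two_of,
    Matrix.det_fin_two_of, div_eq_inv_mul, sq, sq]

/-- The condition on the coefficients of the two fundamental forms that the principal curvatures
have ratio `a`, cleared of denominators. It is homogeneous in each of the two forms, so that the
second one may be taken with respect to any nonzero normal vector. -/
def HasFormRatio (a E F G L M N : K) : Prop :=
  E * N - 2 * F * M + G * L ≠ 0 ∧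
    (1 + a) ^ 2 * ((L * N - M ^ 2) * (E * G - F ^ 2)) = a * (E * N - 2 * F * M + G * L) ^ 2

theorem hasFormRatio_shear_iff (a E F G L M N ψ : K) :
    HasFormRatio a E (F + ψ * E) (G + 2 * ψ * F + ψ ^ 2 * E)
      L (M + ψ * L) (N + 2 * ψ * M + ψ ^ 2 * L) ↔ HasFormRatio a E F G L M N := by
  unfold HasFormRatio
  ring_nf

theorem hasFormRatio_smul_iff {μ ρ : K} (hμ : μ ≠ 0) (hρ : ρ ≠ 0)
    (a E F G L M N : K) :
    HasFormRatio a (μ * E) (μ * F) (μ * G) (ρ * L) (ρ * M) (ρ * N) ↔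
      HasFormRatio a E F G L M N := by
  have hmean : μ * E * (ρ * N) - 2 * (μ * F) * (ρ * M) + μ * G * (ρ * L) =
    μ * ρ * (E * N - 2 * F * M + G * L) := by ring
  have hgauss : (1 + a) ^ 2 *
      ((ρ * L * (ρ * N) - (ρ * M) ^ 2) * (μ * E * (μ * G) - (μ * F) ^ 2)) =
    (μ * ρ) ^ 2 * ((1 + a) ^ 2 * ((L * N - M ^ 2) * (E * G - F ^ 2))) := by ring
  have hμρ : μ * ρ ≠ 0 := mul_ne_zero hμ hρ
  rw [HasFormRatio, HasFormRatio, hmean, hgauss, mul_pow (μ * ρ), mul_left_comm a,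
    mul_right_inj' (pow_ne_zero 2 hμρ), mul_ne_zero_iff_left hμρ]

theorem exists_charpoly_roots_ratio_iff_hasFormRatio {a E F G : K}
    (ha : a ≠ -1) (h : E * G - F ^ 2 ≠ 0) (L M N : K) :
    (∃ x y : K, (!![E, F; F, G]⁻¹ * !![L, M; M, N]).charpoly.roots = {x, y} ∧ y ≠ 0 ∧ x / y = a) ↔
      HasFormRatio a E F G L M N := by
  rw [exists_charpoly_roots_ratio_iff ha, trace_inv_mul_fin_two, det_inv_mul_fin_two, HasFormRatio,
    div_ne_zero_iff, and_iff_left h]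
  field_simp

end EigenvalueRatio

section EuclideanSpace

/-- The cross product of vectors of Euclidean 3-space. -/
def cross (A B : E3) : E3 := WithLp.toLp 2 (A.ofLp ⨯₃ B.ofLp)

theorem hasDerivAt_euclidean {n : ℕ} {γ : ℝ → EuclideanSpace ℝ (Fin n)}
    {w : EuclideanSpace ℝ (Fin n)} {u : ℝ} :
    HasDerivAt γ w u ↔ ∀ i, HasDerivAt (fun x => γ x i) (w i) u := by
  refine ⟨fun h i => (EuclideanSpace.proj (𝕜 := ℝ) i).hasFDerivAt.comp_hasDerivAt u h,
    fun h => ?_⟩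
  have hpi : HasDerivAt (fun x => (γ x).ofLp) w.ofLp u := hasDerivAt_pi.2 h
  exact (PiLp.continuousLinearEquiv 2 ℝ fun _ : Fin n => ℝ).symm.hasFDerivAt.comp_hasDerivAt u hpi

theorem inner_e3 (A B : E3) : ⟪A, B⟫_ℝ = A 0 * B 0 + A 1 * B 1 + A 2 * B 2 := by
  simp only [PiLp.inner_apply, Fin.sum_univ_three, RCLike.inner_apply, conj_trivial]
  ring

theorem cross_eq (A B : E3) :
    cross A B = !₂[A 1 * B 2 - A 2 * B 1, A 2 * B 0 - A 0 * B 2, A 0 * B 1 - A 1 * B 0] := by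
  rw [cross, cross_apply]

theorem inner_cross_left (A B : E3) : ⟪cross A B, A⟫_ℝ = 0 := by
  simp only [inner_e3, cross_eq, Matrix.cons_val]
  ring

theorem inner_cross_right (A B : E3) : ⟪cross A B, B⟫_ℝ = 0 := by
  simp only [inner_e3, cross_eq, Matrix.cons_val]
  ring

theorem norm_cross_sq (A B : E3) : ‖cross A B‖ ^ 2 = ⟪A, A⟫_ℝ * ⟪B, B⟫_ℝ - ⟪A, B⟫_ℝ ^ 2 := by
  rw [← real_inner_self_eq_norm_sq]
  simp only [inner_e3, cross_eq, Matrix.cons_val]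
  ring

theorem linearIndependent_pair_iff_cross_ne_zero (A B : E3) :
    LinearIndependent ℝ ![A, B] ↔ cross A B ≠ 0 := by
  have h : ⇑(WithLp.linearEquiv 2 ℝ (Fin 3 → ℝ)).toLinearMap ∘ ![A, B] = ![A.ofLp, B.ofLp] := by
    ext i
    fin_cases i <;> rfl
  rw [← LinearMap.linearIndependent_iff _ (LinearEquiv.ker (WithLp.linearEquiv 2 ℝ (Fin 3 → ℝ))), h,
    ← crossProduct_ne_zero_iff_linearIndependent, cross, ne_eq, ne_eq, WithLp.toLp_eq_zero]

theorem mem_span_pair_iff_inner_cross_eq_zero {A B : E3} (h : cross A B ≠ 0) (w : E3) :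
    w ∈ Submodule.span ℝ {A, B} ↔ ⟪cross A B, w⟫_ℝ = 0 := by
  have hle : Submodule.span ℝ {A, B} ≤ (ℝ ∙ cross A B)ᗮ := by
    rw [Submodule.span_le]
    rintro _ (rfl | rfl)
    · exact Submodule.mem_orthogonal_singleton_iff_inner_right.2 (inner_cross_left _ _)
    · exact Submodule.mem_orthogonal_singleton_iff_inner_right.2 (inner_cross_right _ _)
  have hspan : Module.finrank ℝ (Submodule.span ℝ {A, B}) = 2 := by
    have h2 := finrank_span_eq_card ((linearIndependent_pair_iff_cross_ne_zero A B).2 h)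
    rwa [Matrix.range_cons_cons_empty, Fintype.card_fin] at h2
  have horth : Module.finrank ℝ (ℝ ∙ cross A B)ᗮ = 2 := by
    have : Fact (Module.finrank ℝ E3 = 2 + 1) := ⟨finrank_euclideanSpace_fin⟩
    exact Submodule.finrank_orthogonal_span_singleton h
  rw [Submodule.eq_of_le_of_finrank_eq hle (hspan.trans horth.symm),
    Submodule.mem_orthogonal_singleton_iff_inner_right]

end EuclideanSpace

section ParametrizedSurface

variable {Φ : ℝ → ℝ → E3} {v u : ℝ}

theorem isRegularAt_iff : IsRegularAt Φ v u ↔ normalVector Φ v u ≠ 0 :=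
  linearIndependent_pair_iff_cross_ne_zero _ _

theorem mem_tangentPlane_iff (h : IsRegularAt Φ v u) (w : E3) :
    w ∈ tangentPlane Φ v u ↔ ⟪normalVector Φ v u, w⟫_ℝ = 0 :=
  mem_span_pair_iff_inner_cross_eq_zero (isRegularAt_iff.1 h) w

theorem hasCurvatureRatioAt_iff {a : ℝ} (ha : a ≠ -1) (h : IsRegularAt Φ v u) :
    HasCurvatureRatioAt Φ a v u ↔
      HasFormRatio a
        ⟪partialFst Φ v u, partialFst Φ v u⟫_ℝ ⟪partialFst Φ v u, partialSnd Φ v u⟫_ℝ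
        ⟪partialSnd Φ v u, partialSnd Φ v u⟫_ℝ
        ⟪normalVector Φ v u, partialFst (partialFst Φ) v u⟫_ℝ
        ⟪normalVector Φ v u, partialFst (partialSnd Φ) v u⟫_ℝ
        ⟪normalVector Φ v u, partialSnd (partialSnd Φ) v u⟫_ℝ := by
  have hn : ‖normalVector Φ v u‖ ≠ 0 := norm_ne_zero_iff.2 (isRegularAt_iff.1 h)
  have hdet := (norm_cross_sq (partialFst Φ v u) (partialSnd Φ v u)).symm.trans_ne
    (pow_ne_zero 2 hn)
  rw [HasCurvatureRatioAt, principalCurvatures, shapeMatrix, firstForm, secondForm,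
    exists_charpoly_roots_ratio_iff_hasFormRatio ha hdet]
  simp only [unitNormal, real_inner_smul_left]
  simpa only [one_mul] using hasFormRatio_smul_iff one_ne_zero (inv_ne_zero hn) ..

theorem partialFst_smul (r : ℝ) (Φ : ℝ → ℝ → E3) : partialFst (r • Φ) = r • partialFst Φ :=
  funext₂ fun _ u => deriv_const_smul_field r (f := fun x => Φ x u)

theorem partialSnd_smul (r : ℝ) (Φ : ℝ → ℝ → E3) : partialSnd (r • Φ) = r • partialSnd Φ :=
  funext₂ fun v _ => deriv_const_smul_field r (f := Φ v)

theorem normalVector_smul (r : ℝ) (Φ : ℝ → ℝ → E3) (v u : ℝ) :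
    normalVector (r • Φ) v u = r ^ 2 • normalVector Φ v u := by
  simp only [normalVector, partialFst_smul, partialSnd_smul, Pi.smul_apply, WithLp.ofLp_smul,
    map_smul, LinearMap.smul_apply, smul_smul, WithLp.toLp_smul, sq]

theorem isRegularAt_smul_iff {r : ℝ} (hr : r ≠ 0) :
    IsRegularAt (r • Φ) v u ↔ IsRegularAt Φ v u := by
  rw [isRegularAt_iff, isRegularAt_iff, normalVector_smul,
    smul_ne_zero_iff_right (pow_ne_zero 2 hr)]

theorem tangentPlane_smul {r : ℝ} (hr : r ≠ 0) :
    tangentPlane (r • Φ) v u = tangentPlane Φ v u := by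
  simp only [tangentPlane, partialFst_smul, partialSnd_smul, Pi.smul_apply]
  rw [← Submodule.span_smul_eq_of_isUnit {partialFst Φ v u, _} r hr.isUnit, Set.smul_set_insert,
    Set.smul_set_singleton]

theorem hasCurvatureRatioAt_smul_iff {a r : ℝ} (ha : a ≠ -1) (hr : r ≠ 0)
    (h : IsRegularAt Φ v u) :
    HasCurvatureRatioAt (r • Φ) a v u ↔ HasCurvatureRatioAt Φ a v u := by
  rw [hasCurvatureRatioAt_iff ha h, hasCurvatureRatioAt_iff ha ((isRegularAt_smul_iff hr).2 h)]
  simp only [normalVector_smul, partialFst_smul, partialSnd_smul, Pi.smul_apply,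
    real_inner_smul_left, real_inner_smul_right, ← mul_assoc, ← sq, ← pow_succ']
  exact hasFormRatio_smul_iff (pow_ne_zero 2 hr) (pow_ne_zero 3 hr) ..

end ParametrizedSurface

section HelicalSurface

/-- The rotation by the angle `θ` about the `z`-axis, as a linear isometry. It is the helical
motion of pitch `0`. -/
def rotation (θ : ℝ) : E3 →ₗᵢ[ℝ] E3 where
  toFun := helicalMotion 0 θ
  map_add' A B := by
    ext i
    fin_cases i <;> simp [helicalMotion] <;> ring
  map_smul' r A := by
    ext i
    fin_cases i <;> simp [helicalMotion] <;> ring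
  norm_map' A := by
    have h : ∀ B : E3, ‖B‖ ^ 2 = B 0 ^ 2 + B 1 ^ 2 + B 2 ^ 2 := fun B => by
      rw [← real_inner_self_eq_norm_sq, inner_e3, sq, sq, sq]
    refine (sq_eq_sq₀ (norm_nonneg _) (norm_nonneg _)).1 ?_
    simp only [LinearMap.coe_mk, AddHom.coe_mk, h, helicalMotion, Matrix.cons_val]
    linear_combination (A 0 ^ 2 + A 1 ^ 2) * Real.sin_sq_add_cos_sq θ

theorem rotation_apply (θ : ℝ) (A : E3) :
    rotation θ A =
      !₂[A 0 * Real.cos θ - A 1 * Real.sin θ, A 0 * Real.sin θ + A 1 * Real.cos θ, A 2] := by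
  change helicalMotion 0 θ A = _
  rw [helicalMotion, zero_mul, add_zero]

theorem cross_rotation (θ : ℝ) (A B : E3) :
    cross (rotation θ A) (rotation θ B) = rotation θ (cross A B) := by
  simp only [cross_eq, rotation_apply, Matrix.cons_val]
  ext i
  fin_cases i
  · simp
    ring
  · simp
    ring
  · simp
    linear_combination (A 0 * B 1 - A 1 * B 0) * Real.sin_sq_add_cos_sq θ

/-- The velocity field of the helical motion of pitch `p`. -/
def helicalField (p : ℝ) (P : E3) : E3 := !₂[-P 1, P 0, p]

theorem helicalField_helicalMotion (p q θ : ℝ) (P : E3) :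
    helicalField p (helicalMotion q θ P) = rotation θ (helicalField p P) := by
  rw [rotation_apply, helicalField, helicalField, helicalMotion]
  ext i
  fin_cases i <;> simp <;> ring

theorem helicalField_rotation (p θ : ℝ) (A : E3) :
    helicalField p (rotation θ A) = rotation θ (helicalField p A) :=
  helicalField_helicalMotion p 0 θ A

theorem helicalMotion_zero (p : ℝ) (P : E3) : helicalMotion p 0 P = P := by
  ext i
  fin_cases i <;> simp [helicalMotion]

theorem helicalMotion_add (p θ v : ℝ) (P : E3) :
    helicalMotion p (θ + v) P = helicalMotion p θ (helicalMotion p v P) := by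
  simp only [helicalMotion, Real.cos_add, Real.sin_add, Matrix.cons_val]
  ext i
  fin_cases i <;> simp <;> ring

theorem helicalMotion_neg_cancel (p θ : ℝ) (P : E3) :
    helicalMotion p θ (helicalMotion p (-θ) P) = P := by
  rw [← helicalMotion_add, add_neg_cancel, helicalMotion_zero]

theorem smul_helicalMotion (r p θ : ℝ) (P : E3) :
    r • helicalMotion p θ P = helicalMotion (r * p) θ (r • P) := by
  ext i
  fin_cases i <;> simp [helicalMotion] <;> ring

theorem hasDerivAt_helicalMotion (p : ℝ) {θ : ℝ → ℝ} {γ : ℝ → E3} {θ' : ℝ} {γ' : E3} {u : ℝ}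
    (hθ : HasDerivAt θ θ' u) (hγ : HasDerivAt γ γ' u) :
    HasDerivAt (fun x => helicalMotion p (θ x) (γ x))
      (rotation (θ u) (γ' + θ' • helicalField p (γ u))) u := by
  have hc := hasDerivAt_euclidean.1 hγ
  refine hasDerivAt_euclidean.2 fun i => ?_
  rw [rotation_apply, helicalField]
  fin_cases i
  · exact (((hc 0).mul hθ.cos).sub ((hc 1).mul hθ.sin)).congr_deriv (by simp; ring)
  · exact (((hc 0).mul hθ.sin).add ((hc 1).mul hθ.cos)).congr_deriv (by simp; ring)
  · exact ((hc 2).add (hθ.const_mul p)).congr_deriv (by simp; ring)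

theorem contDiffOn_helicalMotion (p : ℝ) {n : WithTop ℕ∞} {θ : ℝ → ℝ} {γ : ℝ → E3} {J : Set ℝ}
    (hθ : ContDiffOn ℝ n θ J) (hγ : ContDiffOn ℝ n γ J) :
    ContDiffOn ℝ n (fun x => helicalMotion p (θ x) (γ x)) J := by
  have hc := contDiffOn_euclidean.1 hγ
  refine contDiffOn_euclidean.2 fun i => ?_
  fin_cases i
  · exact ((hc 0).mul hθ.cos).sub ((hc 1).mul hθ.sin)
  · exact ((hc 0).mul hθ.sin).add ((hc 1).mul hθ.cos)
  · exact (hc 2).add (contDiffOn_const.mul hθ)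

variable {c : ℝ → E3} {u : ℝ}

theorem partialFst_helicalSurface (p v u : ℝ) (c : ℝ → E3) :
    partialFst (helicalSurface p c) v u = rotation v (helicalField p (c u)) := by
  have h := (hasDerivAt_helicalMotion p (hasDerivAt_id v) (hasDerivAt_const v (c u))).deriv
  rwa [zero_add, one_smul] at h

theorem partialSnd_helicalSurface (hc : DifferentiableAt ℝ c u) (p v : ℝ) :
    partialSnd (helicalSurface p c) v u = rotation v (deriv c u) := by
  have h := (hasDerivAt_helicalMotion p (hasDerivAt_const u v) hc.hasDerivAt).deriv
  rwa [zero_smul, add_zero] at h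

theorem deriv_rotation_apply (v : ℝ) (A : E3) :
    deriv (fun x => rotation x A) v = rotation v (helicalField 0 A) := by
  have h := (hasDerivAt_helicalMotion 0 (hasDerivAt_id v) (hasDerivAt_const v A)).deriv
  rwa [zero_add, one_smul] at h

theorem partialFst_partialFst_helicalSurface (p v u : ℝ) (c : ℝ → E3) :
    partialFst (partialFst (helicalSurface p c)) v u =
      rotation v (helicalField 0 (helicalField p (c u))) := by
  simp only [partialFst.eq_1 (partialFst _), partialFst_helicalSurface, deriv_rotation_apply]

theorem partialFst_partialSnd_helicalSurface (hc : DifferentiableAt ℝ c u) (p v : ℝ) :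
    partialFst (partialSnd (helicalSurface p c)) v u =
      rotation v (helicalField 0 (deriv c u)) := by
  simp only [partialFst, partialSnd_helicalSurface hc, deriv_rotation_apply]

theorem partialSnd_partialSnd_helicalSurface (hc : ContDiffAt ℝ 2 c u) (p v : ℝ) :
    partialSnd (partialSnd (helicalSurface p c)) v u = rotation v (deriv (deriv c) u) := by
  have h : partialSnd (helicalSurface p c) v =ᶠ[𝓝 u] fun y => rotation v (deriv c y) :=
    (hc.eventually (by simp)).mono fun y hy =>
      partialSnd_helicalSurface (hy.differentiableAt two_ne_zero) p v
  have hc' : DifferentiableAt ℝ (deriv c) u :=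
    (hc.derivWithin (m := 1) (by norm_num)).differentiableAt one_ne_zero
  rw [partialSnd, h.deriv_eq]
  exact ((rotation v).toContinuousLinearMap.hasFDerivAt.comp_hasDerivAt u hc'.hasDerivAt).deriv

/-- The normal vector, at rotation angle `0`, of the helical surface of pitch `p` generated by the
curve `c`. -/
def profileNormal (p : ℝ) (c : ℝ → E3) (u : ℝ) : E3 := cross (helicalField p (c u)) (deriv c u)

theorem normalVector_helicalSurface (hc : DifferentiableAt ℝ c u) (p v : ℝ) :
    normalVector (helicalSurface p c) v u = rotation v (profileNormal p c u) := by
  change cross _ _ = _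
  rw [partialFst_helicalSurface, partialSnd_helicalSurface hc, cross_rotation, profileNormal]

theorem isRegularAt_helicalSurface_iff (hc : DifferentiableAt ℝ c u) (p v : ℝ) :
    IsRegularAt (helicalSurface p c) v u ↔ profileNormal p c u ≠ 0 := by
  rw [isRegularAt_iff, normalVector_helicalSurface hc, ne_eq,
    map_eq_zero_iff _ (rotation v).injective]

theorem hasCurvatureRatioAt_helicalSurface_iff {a p : ℝ} (ha : a ≠ -1) (hc : ContDiffAt ℝ 2 c u)
    (h : profileNormal p c u ≠ 0) (v : ℝ) :
    HasCurvatureRatioAt (helicalSurface p c) a v u ↔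
      HasFormRatio a ⟪helicalField p (c u), helicalField p (c u)⟫_ℝ
        ⟪helicalField p (c u), deriv c u⟫_ℝ ⟪deriv c u, deriv c u⟫_ℝ
        ⟪profileNormal p c u, helicalField 0 (helicalField p (c u))⟫_ℝ
        ⟪profileNormal p c u, helicalField 0 (deriv c u)⟫_ℝ
        ⟪profileNormal p c u, deriv (deriv c) u⟫_ℝ := by
  have hd : DifferentiableAt ℝ c u := hc.differentiableAt two_ne_zero
  rw [hasCurvatureRatioAt_iff ha ((isRegularAt_helicalSurface_iff hd p v).2 h),
    normalVector_helicalSurface hd, partialFst_helicalSurface, partialSnd_helicalSurface hd,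
    partialFst_partialFst_helicalSurface, partialFst_partialSnd_helicalSurface hd,
    partialSnd_partialSnd_helicalSurface hc]
  simp only [LinearIsometry.inner_map_map]

theorem mem_axialParams_iff {p : ℝ} {J : Set ℝ} (hu : u ∈ J) (hc : DifferentiableAt ℝ c u)
    (h : profileNormal p c u ≠ 0) : u ∈ axialParams p c J ↔ profileNormal p c u 2 = 0 := by
  have hreg := (isRegularAt_helicalSurface_iff hc p 0).2 h
  rw [axialParams, mem_ofPred_eq, and_iff_right hu, mem_tangentPlane_iff hreg,
    normalVector_helicalSurface hc, rotation_apply, inner_e3]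
  simp

end HelicalSurface

section Contour

/-- A `C¹` profile curve along which the normals of its helical surface of pitch `1` are orthogonal
to the `x`-axis, that is, a contour of that surface for the projection along this axis. -/
structure IsContour (J : Set ℝ) (Γ : ℝ → E3) : Prop where
  contDiffOn : ContDiffOn ℝ 1 Γ J
  deriv_snd : ∀ u ∈ J, deriv Γ u 1 = Γ u 0 * deriv Γ u 2

/-- The factor `ρ` for which a contour with position `P` and velocity `Q` has the normal
`ρ (0, 1, -x)`. -/
def normalSpeed (P Q : E3) : ℝ := Q 0 + P 1 * Q 2

/-- Up to a nonzero factor, the mean curvature along a contour with position `P` and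
velocity `Q`. -/
def meanFactor (P Q : E3) : ℝ := (1 + P 0 ^ 2) * Q 2 - P 1 * Q 0

/-- The condition that the principal curvatures have ratio `a`, in terms of the position `P` and the
velocity `Q` of a contour. -/
def HasContourRatio (a : ℝ) (P Q : E3) : Prop :=
  meanFactor P Q ≠ 0 ∧
    -((1 + a) ^ 2 * ((1 + P 0 ^ 2) * Q 0 * normalSpeed P Q)) = a * meanFactor P Q ^ 2

theorem HasContourRatio.velocity_fst_ne_zero {a : ℝ} {P Q : E3} (h : HasContourRatio a P Q)
    (ha : a ≠ 0) : Q 0 ≠ 0 := fun hQ =>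
  mul_ne_zero ha (pow_ne_zero 2 h.1) (by rw [← h.2, hQ, mul_zero, zero_mul, mul_zero, neg_zero])

variable {Γ c : ℝ → E3} {φ : ℝ → ℝ} {u : ℝ}

theorem profileNormal_contour (h : deriv Γ u 1 = Γ u 0 * deriv Γ u 2) :
    profileNormal 1 Γ u = normalSpeed (Γ u) (deriv Γ u) • !₂[0, 1, -Γ u 0] := by
  rw [profileNormal, cross_eq, helicalField, normalSpeed]
  ext i
  fin_cases i <;> simp [h]
  ring

theorem profileNormal_of_eventuallyEq_helicalMotion {p : ℝ}
    (hc : c =ᶠ[𝓝 u] fun x => helicalMotion p (φ x) (Γ x)) (hφ : DifferentiableAt ℝ φ u)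
    (hΓ : DifferentiableAt ℝ Γ u) :
    profileNormal p c u = rotation (φ u) (profileNormal p Γ u) := by
  have hderiv := hc.deriv_eq.trans
    (hasDerivAt_helicalMotion p hφ.hasDerivAt hΓ.hasDerivAt).deriv
  rw [profileNormal, profileNormal, hderiv, hc.self_of_nhds, helicalField_helicalMotion,
    cross_rotation, cross_eq, cross_eq]
  congr 1
  ext i
  fin_cases i <;> simp <;> ring

/-- The second derivative of `c` enters only through its inner product with the direction
`m = (0, 1, -x)` of the normal, rotated. As `m` is orthogonal to `c'`, this is `-⟪m', c'⟫`. -/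
theorem inner_deriv_deriv_of_eventuallyEq_helicalMotion (hc : ContDiffAt ℝ 2 c u)
    (hcΓ : ∀ᶠ x in 𝓝 u, c x = helicalMotion 1 (φ x) (Γ x))
    (hφ : ContDiffAt ℝ 1 φ u) (hΓ : ContDiffAt ℝ 1 Γ u)
    (h : ∀ᶠ x in 𝓝 u, deriv Γ x 1 = Γ x 0 * deriv Γ x 2) :
    ⟪rotation (φ u) !₂[0, 1, -Γ u 0], deriv (deriv c) u⟫_ℝ =
      deriv Γ u 0 * deriv Γ u 2 + 2 * deriv φ u * deriv Γ u 0 +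
        deriv φ u ^ 2 * (-Γ u 1) := by
  have hderiv : ∀ᶠ x in 𝓝 u,
      deriv c x = rotation (φ x) (deriv Γ x + deriv φ x • helicalField 1 (Γ x)) := by
    filter_upwards [hcΓ.eventually_nhds, hφ.eventually (by simp), hΓ.eventually (by simp)]
      with x hx hφx hΓx
    exact (EventuallyEq.deriv_eq hx).trans (hasDerivAt_helicalMotion 1
      (hφx.differentiableAt one_ne_zero).hasDerivAt
      (hΓx.differentiableAt one_ne_zero).hasDerivAt).deriv
  have horth : (fun x => ⟪rotation (φ x) !₂[0, 1, -Γ x 0], deriv c x⟫_ℝ) =ᶠ[𝓝 u] 0 := by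
    filter_upwards [hderiv, h] with x hx hΓx
    rw [hx, LinearIsometry.inner_map_map, inner_e3, helicalField]
    simp [hΓx]
    ring
  have hm : HasDerivAt (fun x => rotation (φ x) !₂[0, 1, -Γ x 0])
      (rotation (φ u) !₂[-deriv φ u, 0, -deriv Γ u 0]) u := by
    have hν : HasDerivAt (fun x => (!₂[0, 1, -Γ x 0] : E3)) !₂[0, 0, -deriv Γ u 0] u := by
      refine hasDerivAt_euclidean.2 fun i => ?_
      fin_cases i
      exacts [hasDerivAt_const _ _, hasDerivAt_const _ _,
        (hasDerivAt_euclidean.1 (hΓ.differentiableAt one_ne_zero).hasDerivAt 0).neg]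
    refine (hasDerivAt_helicalMotion 0
      (hφ.differentiableAt one_ne_zero).hasDerivAt hν).congr_deriv ?_
    congr 1
    ext i
    fin_cases i <;> simp [helicalField]
  have hc' : HasDerivAt (deriv c) (deriv (deriv c) u) u :=
    ((hc.derivWithin (m := 1) (by norm_num)).differentiableAt one_ne_zero).hasDerivAt
  have hzero := ((hm.inner ℝ hc').congr_of_eventuallyEq horth.symm).unique (hasDerivAt_const u 0)
  rw [hderiv.self_of_nhds, LinearIsometry.inner_map_map] at hzero
  rw [eq_neg_of_add_eq_zero_left hzero, inner_e3, helicalField]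
  simp
  ring

theorem hasFormRatio_contour_iff {a : ℝ} {P Q : E3} (hQ : Q 1 = P 0 * Q 2)
    (hρ : normalSpeed P Q ≠ 0) :
    HasFormRatio a ⟪helicalField 1 P, helicalField 1 P⟫_ℝ ⟪helicalField 1 P, Q⟫_ℝ ⟪Q, Q⟫_ℝ
      (-P 1) (Q 0) (Q 0 * Q 2) ↔ HasContourRatio a P Q := by
  set E := ⟪helicalField 1 P, helicalField 1 P⟫_ℝ with hE
  set F := ⟪helicalField 1 P, Q⟫_ℝ with hF
  set G := ⟪Q, Q⟫_ℝ with hG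
  have hmean : E * (Q 0 * Q 2) - 2 * F * Q 0 + G * -P 1 = -normalSpeed P Q * meanFactor P Q := by
    simp only [hE, hF, hG, inner_e3, helicalField, normalSpeed, meanFactor, hQ, Matrix.cons_val]
    ring
  have hgauss : (-P 1 * (Q 0 * Q 2) - Q 0 ^ 2) * (E * G - F ^ 2) =
      normalSpeed P Q ^ 2 * -((1 + P 0 ^ 2) * Q 0 * normalSpeed P Q) := by
    simp only [hE, hF, hG, inner_e3, helicalField, normalSpeed, hQ, Matrix.cons_val]
    ring
  rw [HasFormRatio, HasContourRatio, hmean, hgauss, mul_ne_zero_iff_left (neg_ne_zero.2 hρ),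
    mul_left_comm, mul_neg ((1 + a) ^ 2), mul_pow, neg_sq, mul_left_comm a,
    mul_right_inj' (pow_ne_zero 2 hρ)]

theorem hasFormRatio_contour_shear_iff {a : ℝ} {P Q : E3} (hQ : Q 1 = P 0 * Q 2)
    (hρ : normalSpeed P Q ≠ 0) (ψ : ℝ) :
    HasFormRatio a ⟪helicalField 1 P, helicalField 1 P⟫_ℝ
      ⟪helicalField 1 P, Q + ψ • helicalField 1 P⟫_ℝ
      ⟪Q + ψ • helicalField 1 P, Q + ψ • helicalField 1 P⟫_ℝ
      ⟪!₂[0, 1, -P 0], helicalField 0 (helicalField 1 P)⟫_ℝ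
      ⟪!₂[0, 1, -P 0], helicalField 0 (Q + ψ • helicalField 1 P)⟫_ℝ
      (Q 0 * Q 2 + 2 * ψ * Q 0 + ψ ^ 2 * (-P 1)) ↔ HasContourRatio a P Q := by
  set W := helicalField 1 P with hW
  have hF : ⟪W, Q + ψ • W⟫_ℝ = ⟪W, Q⟫_ℝ + ψ * ⟪W, W⟫_ℝ := by
    rw [inner_add_right, real_inner_smul_right]
  have hG : ⟪Q + ψ • W, Q + ψ • W⟫_ℝ = ⟪Q, Q⟫_ℝ + 2 * ψ * ⟪W, Q⟫_ℝ + ψ ^ 2 * ⟪W, W⟫_ℝ := by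
    rw [inner_add_left, real_inner_smul_left, hF, inner_add_right, real_inner_smul_right,
      real_inner_comm W Q]
    ring
  have hL : ⟪!₂[0, 1, -P 0], helicalField 0 W⟫_ℝ = -P 1 := by
    simp [inner_e3, hW, helicalField]
  have hM : ⟪!₂[0, 1, -P 0], helicalField 0 (Q + ψ • W)⟫_ℝ = Q 0 + ψ * -P 1 := by
    simp [inner_e3, hW, helicalField]
  rw [hF, hG, hL, hM, hasFormRatio_shear_iff, hW, hasFormRatio_contour_iff hQ hρ]

theorem hasCurvatureRatioAt_iff_hasContourRatio {a : ℝ} (ha : a ≠ -1) (hc : ContDiffAt ℝ 2 c u)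
    (hcΓ : ∀ᶠ x in 𝓝 u, c x = helicalMotion 1 (φ x) (Γ x))
    (hφ : ContDiffAt ℝ 1 φ u) (hΓ : ContDiffAt ℝ 1 Γ u)
    (h : ∀ᶠ x in 𝓝 u, deriv Γ x 1 = Γ x 0 * deriv Γ x 2)
    (hρ : normalSpeed (Γ u) (deriv Γ u) ≠ 0) (v : ℝ) :
    HasCurvatureRatioAt (helicalSurface 1 c) a v u ↔ HasContourRatio a (Γ u) (deriv Γ u) := by
  have hφd := hφ.differentiableAt one_ne_zero
  have hΓd := hΓ.differentiableAt one_ne_zero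
  have hν : (!₂[0, 1, -Γ u 0] : E3) ≠ 0 := fun h0 => one_ne_zero (congrArg (· 1) h0)
  have hn : profileNormal 1 c u =
      normalSpeed (Γ u) (deriv Γ u) • rotation (φ u) !₂[0, 1, -Γ u 0] := by
    rw [profileNormal_of_eventuallyEq_helicalMotion hcΓ hφd hΓd,
      profileNormal_contour h.self_of_nhds, map_smul]
  have hn0 : profileNormal 1 c u ≠ 0 := by
    rwa [hn, smul_ne_zero_iff_right hρ, ne_eq, map_eq_zero_iff _ (rotation _).injective]
  have hc' : deriv c u = rotation (φ u) (deriv Γ u + deriv φ u • helicalField 1 (Γ u)) :=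
    (EventuallyEq.deriv_eq hcΓ).trans
      (hasDerivAt_helicalMotion 1 hφd.hasDerivAt hΓd.hasDerivAt).deriv
  rw [hasCurvatureRatioAt_helicalSurface_iff ha hc hn0, hn]
  simp only [real_inner_smul_left]
  rw [inner_deriv_deriv_of_eventuallyEq_helicalMotion hc hcΓ hφ hΓ h, hc', hcΓ.self_of_nhds]
  simp only [helicalField_helicalMotion, helicalField_rotation, LinearIsometry.inner_map_map]
  rw [← hasFormRatio_contour_shear_iff h.self_of_nhds hρ (deriv φ u)]
  simpa only [one_mul] using hasFormRatio_smul_iff one_ne_zero hρ ..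

end Contour

section ContourExistence

variable {J : Set ℝ} {Γ c : ℝ → E3} {φ : ℝ → ℝ} {u : ℝ}

theorem contDiffOn_profileNormal (hJ : IsOpen J) (hc : ContDiffOn ℝ 2 c J) (p : ℝ) :
    ContDiffOn ℝ 1 (profileNormal p c) J := by
  have hc1 := contDiffOn_euclidean.1 (hc.of_le one_le_two)
  have hc' := contDiffOn_euclidean.1 (hc.deriv_of_isOpen (m := 1) hJ (by norm_num))
  unfold profileNormal
  simp only [cross_eq, helicalField, Matrix.cons_val]
  refine contDiffOn_euclidean.2 fun i => ?_
  fin_cases i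
  · exact ((hc1 0).mul (hc' 2)).sub (contDiffOn_const.mul (hc' 1))
  · exact (contDiffOn_const.mul (hc' 0)).sub ((hc1 1).neg.mul (hc' 2))
  · exact ((hc1 1).neg.mul (hc' 1)).sub ((hc1 0).mul (hc' 0))

theorem exists_rotation_apply_fst_eq_zero (hJ : IsOpen J) (hJc : J.OrdConnected) {n : ℝ → E3}
    (hn : ContDiffOn ℝ 1 n J) (h0 : ∀ u ∈ J, n u 0 ≠ 0 ∨ n u 1 ≠ 0) :
    ∃ φ : ℝ → ℝ, ContDiffOn ℝ 1 φ J ∧ ∀ u ∈ J, rotation (-φ u) (n u) 0 = 0 := by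
  have hni := contDiffOn_euclidean.1 hn
  have hf : ContDiffOn ℝ 1 (fun u => (n u 1 : ℂ) - n u 0 * Complex.I) J :=
    (Complex.ofRealCLM.contDiff.comp_contDiffOn (hni 1)).sub
      ((Complex.ofRealCLM.contDiff.comp_contDiffOn (hni 0)).mul contDiffOn_const)
  obtain ⟨θ, hθ, hexp⟩ := exists_contDiffOn_exp_eq hJ hJc hf fun u hu h => by
    have hre : n u 1 = 0 := by simpa using congrArg Complex.re h
    have him : n u 0 = 0 := by simpa using congrArg Complex.im h
    exact (h0 u hu).elim (· him) (· hre)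
  refine ⟨fun u => (θ u).im, Complex.imCLM.contDiff.comp_contDiffOn hθ, fun u hu => ?_⟩
  have hre : Real.exp (θ u).re * Real.cos (θ u).im = n u 1 := by
    rw [← Complex.exp_re, hexp u hu]
    simp
  have him : Real.exp (θ u).re * Real.sin (θ u).im = -n u 0 := by
    rw [← Complex.exp_im, hexp u hu]
    simp
  simp only [rotation_apply, Real.cos_neg, Real.sin_neg, Matrix.cons_val]
  linear_combination -Real.sin (θ u).im * hre + Real.cos (θ u).im * him

theorem exists_isContour (hJ : IsOpen J) (hJc : J.OrdConnected) (hc : ContDiffOn ℝ 2 c J)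
    (hn : ∀ u ∈ J, profileNormal 1 c u ≠ 0) :
    ∃ (φ : ℝ → ℝ) (Γ : ℝ → E3), ContDiffOn ℝ 1 φ J ∧ IsContour J Γ ∧
      ∀ u ∈ J, c u = helicalMotion 1 (φ u) (Γ u) := by
  obtain ⟨φ, hφ, hrot⟩ := exists_rotation_apply_fst_eq_zero hJ hJc
    (contDiffOn_profileNormal hJ hc 1) fun u hu => by
      by_contra! h
      have horth : ⟪profileNormal 1 c u, helicalField 1 (c u)⟫_ℝ = 0 := inner_cross_left _ _
      refine hn u hu ?_
      rw [inner_e3, h.1, h.2, helicalField] at horth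
      ext i
      fin_cases i
      exacts [h.1, h.2, by simpa using horth]
  have hc1 := hc.of_le one_le_two
  refine ⟨φ, fun u => helicalMotion 1 (-φ u) (c u), hφ,
    ⟨contDiffOn_helicalMotion 1 hφ.neg hc1, fun u hu => ?_⟩,
    fun u _ => (helicalMotion_neg_cancel 1 (φ u) (c u)).symm⟩
  have hJu := hJ.mem_nhds hu
  have h := hrot u hu
  rw [← profileNormal_of_eventuallyEq_helicalMotion EventuallyEq.rfl
    (φ := fun u => -φ u) ((hφ.contDiffAt hJu).differentiableAt one_ne_zero).neg
    ((hc1.contDiffAt hJu).differentiableAt one_ne_zero), profileNormal, cross_eq,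
    helicalField] at h
  simp only [Matrix.cons_val, one_mul] at h
  linear_combination -h

theorem IsContour.profileNormal_eq (hΓ : IsContour J Γ) (hJ : IsOpen J) (hφ : ContDiffOn ℝ 1 φ J)
    (hcΓ : ∀ u ∈ J, c u = helicalMotion 1 (φ u) (Γ u)) (hu : u ∈ J) :
    profileNormal 1 c u =
      normalSpeed (Γ u) (deriv Γ u) • rotation (φ u) !₂[0, 1, -Γ u 0] := by
  have hJu := hJ.mem_nhds hu
  rw [profileNormal_of_eventuallyEq_helicalMotion (eventually_of_mem hJu hcΓ)
    ((hφ.contDiffAt hJu).differentiableAt one_ne_zero)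
    ((hΓ.contDiffOn.contDiffAt hJu).differentiableAt one_ne_zero),
    profileNormal_contour (hΓ.deriv_snd u hu), map_smul]

theorem IsContour.axialParams_eq (hΓ : IsContour J Γ) (hJ : IsOpen J) (hc : ContDiffOn ℝ 1 c J)
    (hn : ∀ u ∈ J, profileNormal 1 c u ≠ 0) (hφ : ContDiffOn ℝ 1 φ J)
    (hcΓ : ∀ u ∈ J, c u = helicalMotion 1 (φ u) (Γ u)) :
    axialParams 1 c J = {u ∈ J | Γ u 0 = 0} := by
  ext u
  refine and_congr_right_iff.2 fun hu => ?_
  have hρ := hΓ.profileNormal_eq hJ hφ hcΓ hu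
  have hax := mem_axialParams_iff hu
    ((hc.contDiffAt (hJ.mem_nhds hu)).differentiableAt one_ne_zero) (hn u hu)
  rw [hρ, PiLp.smul_apply, rotation_apply, smul_eq_mul,
    mul_eq_zero_iff_left fun h0 => hn u hu (by rw [hρ, h0, zero_smul])] at hax
  simpa [axialParams, hu] using hax

/-- A contour along which the helical surface of pitch `1` has principal curvature ratio `a`,
oriented by the sign of its velocity in the direction of the `x`-axis. -/
structure IsCRPCContour (a : ℝ) (J : Set ℝ) (Γ : ℝ → E3) : Prop extends IsContour J Γ where
  hasContourRatio : ∀ u ∈ J, HasContourRatio a (Γ u) (deriv Γ u)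
  pos : ∀ u ∈ J, 0 < meanFactor (Γ u) (deriv Γ u) * deriv Γ u 0

variable {a : ℝ}

theorem IsContour.hasDerivAt_apply (hΓ : IsContour J Γ) (hJ : IsOpen J) (hu : u ∈ J) (i : Fin 3) :
    HasDerivAt (fun u => Γ u i) (deriv Γ u i) u :=
  hasDerivAt_euclidean.1
    ((hΓ.contDiffOn.contDiffAt (hJ.mem_nhds hu)).differentiableAt one_ne_zero).hasDerivAt i

theorem IsContour.continuousOn_deriv (hΓ : IsContour J Γ) (hJ : IsOpen J) :
    ContinuousOn (deriv Γ) J :=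
  hΓ.contDiffOn.continuousOn_deriv_of_isOpen hJ le_rfl

theorem IsContour.continuousOn_meanFactor (hΓ : IsContour J Γ) (hJ : IsOpen J) :
    ContinuousOn (fun u => meanFactor (Γ u) (deriv Γ u)) J := by
  have hc := hΓ.contDiffOn.continuousOn
  have hc' := hΓ.continuousOn_deriv hJ
  unfold meanFactor
  fun_prop

theorem IsContour.isCRPCContour_halfTurn (hΓ : IsContour J Γ) (hJ : IsOpen J)
    (hratio : ∀ u ∈ J, HasContourRatio a (Γ u) (deriv Γ u))
    (hneg : ∀ u ∈ J, meanFactor (Γ u) (deriv Γ u) * deriv Γ u 0 < 0) :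
    IsCRPCContour a J fun u => helicalMotion 1 (-Real.pi) (Γ u) := by
  have hmotion (P : E3) : helicalMotion 1 (-Real.pi) P = !₂[-P 0, -P 1, P 2 - Real.pi] := by
    ext i
    fin_cases i <;> simp [helicalMotion, sub_eq_add_neg]
  have hderiv : ∀ u ∈ J, deriv (fun u => helicalMotion 1 (-Real.pi) (Γ u)) u =
      !₂[-deriv Γ u 0, -deriv Γ u 1, deriv Γ u 2] := fun u hu => by
    have hd := (hΓ.contDiffOn.contDiffAt (hJ.mem_nhds hu)).differentiableAt one_ne_zero
    rw [(hasDerivAt_helicalMotion 1 (hasDerivAt_const u (-Real.pi)) hd.hasDerivAt).deriv,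
      rotation_apply]
    ext i
    fin_cases i <;> simp
  have hmean (P Q : E3) : meanFactor !₂[-P 0, -P 1, P 2 - Real.pi] !₂[-Q 0, -Q 1, Q 2] =
      meanFactor P Q := by
    simp [meanFactor]
  have hspeed (P Q : E3) : normalSpeed !₂[-P 0, -P 1, P 2 - Real.pi] !₂[-Q 0, -Q 1, Q 2] =
      -normalSpeed P Q := by
    simp [normalSpeed]
    ring
  refine ⟨⟨contDiffOn_helicalMotion 1 contDiffOn_const hΓ.contDiffOn, fun u hu => ?_⟩,
    fun u hu => ?_, fun u hu => ?_⟩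
  · rw [hderiv u hu, hmotion]
    simp [hΓ.deriv_snd u hu]
  · rw [hderiv u hu, hmotion, HasContourRatio, hmean, hspeed]
    simpa [HasContourRatio] using hratio u hu
  · rw [hderiv u hu, hmotion, hmean]
    simpa using hneg u hu

theorem exists_isCRPCContour (ha0 : a ≠ 0) (ha : a ≠ -1) (hJ : IsOpen J) (hJc : J.OrdConnected)
    (hc : ContDiffOn ℝ 2 c J) (hn : ∀ u ∈ J, profileNormal 1 c u ≠ 0)
    (hratio : ∀ u ∈ J, HasCurvatureRatioAt (helicalSurface 1 c) a 0 u) :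
    ∃ (φ : ℝ → ℝ) (Γ : ℝ → E3), ContDiffOn ℝ 1 φ J ∧ IsCRPCContour a J Γ ∧
      ∀ u ∈ J, c u = helicalMotion 1 (φ u) (Γ u) := by
  obtain ⟨φ, Γ, hφ, hΓ, hcΓ⟩ := exists_isContour hJ hJc hc hn
  have hcont : ∀ u ∈ J, HasContourRatio a (Γ u) (deriv Γ u) := fun u hu => by
    have hJu := hJ.mem_nhds hu
    refine (hasCurvatureRatioAt_iff_hasContourRatio ha (hc.contDiffAt hJu)
      (eventually_of_mem hJu hcΓ) (hφ.contDiffAt hJu) (hΓ.contDiffOn.contDiffAt hJu)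
      (eventually_of_mem hJu hΓ.deriv_snd) (fun h0 => hn u hu ?_) 0).1 (hratio u hu)
    rw [hΓ.profileNormal_eq hJ hφ hcΓ hu, h0, zero_smul]
  have hc' := hΓ.continuousOn_deriv hJ
  rcases forall_pos_or_forall_neg hJc.isPreconnected
    ((hΓ.continuousOn_meanFactor hJ).mul (by fun_prop : ContinuousOn (fun u => deriv Γ u 0) J))
    fun u hu => mul_ne_zero (hcont u hu).1 ((hcont u hu).velocity_fst_ne_zero ha0) with h | h
  · exact ⟨φ, Γ, hφ, ⟨hΓ, hcont, h⟩, hcΓ⟩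
  · refine ⟨fun u => φ u + Real.pi, _, hφ.add contDiffOn_const,
      hΓ.isCRPCContour_halfTurn hJ hcont h, fun u hu => ?_⟩
    rw [helicalMotion_add, helicalMotion_neg_cancel, hcΓ u hu]

end ContourExistence

section ExplicitProfile

variable {k C s : ℝ}

theorem ratioParam_pos {a : ℝ} (ha1 : a ≠ 1) (ha : a ≠ -1) : 0 < ratioParam a :=
  abs_pos.2 (div_ne_zero (sub_ne_zero.2 ha1) fun h => ha (eq_neg_of_add_eq_zero_left h))

theorem ratioParam_sq {a : ℝ} (ha : a ≠ -1) : (1 - ratioParam a ^ 2) * (1 + a) ^ 2 = 4 * a := by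
  have h : a + 1 ≠ 0 := fun h => ha (eq_neg_of_add_eq_zero_left h)
  rw [ratioParam, sq_abs]
  field_simp
  ring

/-- The ratio of `g` and `√h / 2` as a function of `s`. It does not depend on `C`. -/
def slopeFun (k s : ℝ) : ℝ := ((k - 1) * s ^ 2 - (k + 1)) / (2 * k * s)

theorem hasDerivAt_slopeFun (hk : k ≠ 0) (hs : s ≠ 0) :
    HasDerivAt (slopeFun k) (((k - 1) * s ^ 2 + (k + 1)) / (2 * k * s ^ 2)) s := by
  have h := (((hasDerivAt_pow 2 s).const_mul (k - 1)).sub_const (k + 1)).div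
    ((hasDerivAt_id s).const_mul (2 * k)) (mul_ne_zero (mul_ne_zero two_ne_zero hk) hs)
  refine h.congr_deriv ?_
  simp only [id_eq]
  field_simp
  ring

theorem contDiffOn_slopeFun (hk : k ≠ 0) {n : WithTop ℕ∞} :
    ContDiffOn ℝ n (slopeFun k) (Ioi 0) :=
  ((contDiffOn_const.mul (contDiffOn_id.pow 2)).sub contDiffOn_const).div
    (contDiffOn_const.mul contDiffOn_id)
    fun _ hs => mul_ne_zero (mul_ne_zero two_ne_zero hk) (ne_of_gt hs)

theorem slopeFun_le_of_critical (hk : 0 < k) (h : (k - 1) * s ^ 2 + (k + 1) = 0) {t : ℝ}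
    (ht : 0 < t) : slopeFun k t ≤ slopeFun k s := by
  have : s ≠ 0 := by
    rintro rfl
    linarith
  have hk1 : k + 1 = (1 - k) * s ^ 2 := by linarith
  have h1k : 0 < 1 - k := pos_of_mul_pos_left (hk1 ▸ by positivity) (sq_nonneg s)
  have hdiff : slopeFun k s - slopeFun k t = (1 - k) * (t - s) ^ 2 / (2 * k * t) := by
    rw [slopeFun, slopeFun, hk1]
    field_simp
    ring
  exact sub_nonneg.1 (hdiff ▸ by positivity)

theorem hFun_eq_mul (k C s : ℝ) : hFun k C s = C * hFun k 1 s := by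
  rw [hFun, hFun]
  ring

theorem hFun_pos (hC : 0 < C) (hs : 0 < s) : 0 < hFun k C s := by
  have := Real.rpow_pos_of_pos hs (k + 1)
  unfold hFun
  positivity

theorem hasDerivAt_hFun (k C : ℝ) (hs : 0 < s) :
    HasDerivAt (hFun k C)
      (hFun k C s * ((k - 1) * s ^ 2 + (k + 1)) / (s * (s ^ 2 + 1))) s := by
  have h := ((((hasDerivAt_id s).rpow_const (p := k + 1) (Or.inl hs.ne')).const_mul (2 * C))).div
    ((hasDerivAt_pow 2 s).add_const 1) (by positivity)
  refine h.congr_deriv ?_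
  rw [hFun, add_sub_cancel_right]
  simp only [id_eq]
  rw [Real.rpow_add_one hs.ne' k]
  field_simp
  ring

theorem contDiffOn_hFun (k C : ℝ) {n : WithTop ℕ∞} : ContDiffOn ℝ n (hFun k C) (Ioi 0) := by
  refine (contDiffOn_const.mul
    (contDiffOn_id.rpow_const_of_ne fun s hs => ne_of_gt hs)).div
    ((contDiffOn_id.pow 2).add contDiffOn_const) fun s _ => ?_
  change s ^ 2 + 1 ≠ 0
  positivity

theorem isOpen_domainI (k C : ℝ) : IsOpen (domainI k C) :=
  (contDiffOn_hFun k C (n := 0)).continuousOn.isOpen_inter_preimage isOpen_Ioi isOpen_Ioi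

theorem domainI_subset_Ioi (k C : ℝ) : domainI k C ⊆ Ioi 0 := fun _ hs => hs.1

theorem one_lt_hFun_iff (hs : 0 < s) :
    1 < hFun k C s ↔
      Real.exp ((1 - k) * Real.log s) + Real.exp (-(1 + k) * Real.log s) < 2 * C := by
  have hr := Real.rpow_pos_of_pos hs (k + 1)
  have h1 : Real.exp ((1 - k) * Real.log s) = s ^ 2 / s ^ (k + 1) := by
    rw [← Real.rpow_natCast, ← Real.rpow_sub hs, Real.rpow_def_of_pos hs]
    push_cast
    ring_nf
  have h2 : Real.exp (-(1 + k) * Real.log s) = 1 / s ^ (k + 1) := by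
    rw [one_div, ← Real.rpow_neg hs.le, Real.rpow_def_of_pos hs]
    ring_nf
  rw [h1, h2, ← add_div, div_lt_iff₀ hr, hFun, one_lt_div (by positivity)]

theorem convexOn_exp_mul (b : ℝ) : ConvexOn ℝ univ fun x : ℝ => Real.exp (b * x) :=
  convexOn_exp.comp_linearMap (LinearMap.mulLeft ℝ b)

theorem ordConnected_domainI (k C : ℝ) : (domainI k C).OrdConnected := by
  have hconv := (((convexOn_exp_mul (1 - k)).add (convexOn_exp_mul (-(1 + k)))).convex_lt
    (2 * C)).ordConnected
  refine ⟨fun x hx y hy z hz => ?_⟩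
  have hz0 : 0 < z := hx.1.trans_le hz.1
  exact ⟨hz0, (one_lt_hFun_iff hz0).2 (hconv.out ⟨mem_univ _, (one_lt_hFun_iff hx.1).1 hx.2⟩
    ⟨mem_univ _, (one_lt_hFun_iff hy.1).1 hy.2⟩
    ⟨Real.log_le_log hx.1 hz.1, Real.log_le_log hz0 hz.2⟩).2⟩

theorem gFun_eq (k C : ℝ) : gFun k C = fun s => slopeFun k s * √(hFun k C s) / 2 := by
  funext s
  rw [gFun, slopeFun]
  ring

theorem hasDerivAt_gFun (hk : k ≠ 0) (hC : 0 < C) (hs : 0 < s) :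
    HasDerivAt (gFun k C) (((k - 1) * s ^ 2 + (k + 1)) * ((k + 1) * s ^ 2 - (k - 1)) *
      √(hFun k C s) / (8 * k * s ^ 2 * (s ^ 2 + 1))) s := by
  have hh := hFun_pos (k := k) hC hs
  rw [gFun_eq]
  refine (((hasDerivAt_slopeFun hk hs.ne').mul
    ((hasDerivAt_hFun k C hs).sqrt hh.ne')).div_const 2).congr_deriv ?_
  rw [slopeFun]
  nth_rewrite 2 [← Real.sq_sqrt hh.le]
  field_simp
  ring

theorem contDiffOn_gFun (hk : k ≠ 0) (hC : 0 < C) {n : WithTop ℕ∞} :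
    ContDiffOn ℝ n (gFun k C) (Ioi 0) := by
  rw [gFun_eq]
  exact ((contDiffOn_slopeFun hk).mul ((contDiffOn_hFun k C).sqrt
    fun _ hs => (hFun_pos hC hs).ne')).div_const 2

theorem tFun_pos (hs : s ∈ domainI k C) : 0 < tFun k C s :=
  Real.sqrt_pos.2 (sub_pos.2 hs.2)

theorem tFun_sq (hs : s ∈ domainI k C) : tFun k C s ^ 2 = hFun k C s - 1 :=
  Real.sq_sqrt (sub_pos.2 hs.2).le

theorem hasDerivAt_tFun (hs : s ∈ domainI k C) :
    HasDerivAt (tFun k C) (hFun k C s * ((k - 1) * s ^ 2 + (k + 1)) / (s * (s ^ 2 + 1)) /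
      (2 * tFun k C s)) s :=
  ((hasDerivAt_hFun k C hs.1).sub_const 1).sqrt (sub_pos.2 hs.2).ne'

theorem contDiffOn_tFun (k C : ℝ) {n : WithTop ℕ∞} : ContDiffOn ℝ n (tFun k C) (domainI k C) :=
  (((contDiffOn_hFun k C).mono (domainI_subset_Ioi k C)).sub contDiffOn_const).sqrt
    fun _ hs => (sub_pos.2 hs.2).ne'

theorem contDiffOn_deriv_gFun_div_tFun (hk : k ≠ 0) (hC : 0 < C) :
    ContDiffOn ℝ 1 (fun s => deriv (gFun k C) s / tFun k C s) (domainI k C) :=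
  (((contDiffOn_gFun hk hC).mono (domainI_subset_Ioi k C)).deriv_of_isOpen (n := 2)
    (isOpen_domainI k C) (by norm_num)).div (contDiffOn_tFun k C) fun _ hs => (tFun_pos hs).ne'

theorem exists_isHeight (hk : k ≠ 0) (hC : 0 < C) : ∃ Z : ℝ → ℝ, IsHeight k C Z :=
  exists_hasDerivAt_of_continuousOn (isOpen_domainI k C) (ordConnected_domainI k C)
    (contDiffOn_deriv_gFun_div_tFun hk hC).continuousOn

theorem IsHeight.add_const {Z : ℝ → ℝ} (hZ : IsHeight k C Z) (b : ℝ) :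
    IsHeight k C fun s => Z s + b := fun s hs => (hZ s hs).add_const b

theorem IsHeight.contDiffOn {Z : ℝ → ℝ} (hZ : IsHeight k C Z) (hk : k ≠ 0) (hC : 0 < C) :
    ContDiffOn ℝ 2 Z (domainI k C) :=
  (contDiffOn_succ_of_hasDerivAt (n := 1) (isOpen_domainI k C) hZ
    (contDiffOn_deriv_gFun_div_tFun hk hC)).of_le (by norm_num)

/-- The sign of the `x`-coordinate of the profile curve `X_i`. -/
def profileSign (i : Fin 2) : ℝ := if i = 0 then 1 else -1

theorem profileSign_sq (i : Fin 2) : profileSign i ^ 2 = 1 := by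
  fin_cases i <;> simp [profileSign]

theorem two_smul_profileCurve (k C : ℝ) (Z : ℝ → ℝ) (i : Fin 2) (s : ℝ) :
    (2 : ℝ) • profileCurve k C Z i s =
      !₂[profileSign i * tFun k C s, 2 * gFun k C s, 2 * (profileSign i * Z s)] := by
  ext j
  fin_cases i <;> fin_cases j <;> simp [profileCurve, profileSign, mul_div_cancel₀]

theorem helicalSurface_eq_smul {p : ℝ} (hp : p ≠ 0) (c : ℝ → E3) :
    helicalSurface p c = p • helicalSurface 1 (p⁻¹ • c) := by
  funext v u
  rw [Pi.smul_apply, Pi.smul_apply, helicalSurface, helicalSurface, smul_helicalMotion, mul_one,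
    Pi.smul_apply, smul_inv_smul₀ hp]

theorem explicitSurface_eq_smul (p k C : ℝ) (Z : ℝ → ℝ) (i : Fin 2) :
    explicitSurface p k C Z i = p • helicalSurface 1 ((2 : ℝ) • profileCurve k C Z i) := by
  funext v s
  rw [Pi.smul_apply, Pi.smul_apply, helicalSurface, explicitSurface, mul_comm, mul_smul,
    smul_helicalMotion 2, mul_one_div_cancel two_ne_zero, Pi.smul_apply]

end ExplicitProfile

section ExplicitContour

variable {k C s : ℝ} {Z : ℝ → ℝ}

theorem contDiffOn_two_smul_profileCurve (hk : k ≠ 0) (hC : 0 < C) (hZ : IsHeight k C Z)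
    (i : Fin 2) : ContDiffOn ℝ 2 ((2 : ℝ) • profileCurve k C Z i) (domainI k C) := by
  have ht : ContDiffOn ℝ 2 (tFun k C) (domainI k C) := contDiffOn_tFun k C
  have hg : ContDiffOn ℝ 2 (gFun k C) (domainI k C) :=
    (contDiffOn_gFun hk hC).mono (domainI_subset_Ioi k C)
  refine contDiffOn_euclidean.2 fun j => ?_
  simp only [Pi.smul_apply, two_smul_profileCurve]
  fin_cases j
  exacts [contDiffOn_const.mul ht, contDiffOn_const.mul hg,
    contDiffOn_const.mul (contDiffOn_const.mul (hZ.contDiffOn hk hC))]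

theorem deriv_two_smul_profileCurve (hk : k ≠ 0) (hC : 0 < C) (hZ : IsHeight k C Z) (i : Fin 2)
    (hs : s ∈ domainI k C) :
    deriv ((2 : ℝ) • profileCurve k C Z i) s =
      !₂[profileSign i * deriv (tFun k C) s, 2 * deriv (gFun k C) s,
        2 * (profileSign i * (deriv (gFun k C) s / tFun k C s))] := by
  refine (hasDerivAt_euclidean.2 fun j => ?_).deriv
  simp only [Pi.smul_apply, two_smul_profileCurve]
  fin_cases j
  exacts [(hasDerivAt_tFun hs).differentiableAt.hasDerivAt.const_mul _,
    (hasDerivAt_gFun hk hC hs.1).differentiableAt.hasDerivAt.const_mul _,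
    ((hZ s hs).const_mul _).const_mul _]

theorem isContour_two_smul_profileCurve (hk : k ≠ 0) (hC : 0 < C) (hZ : IsHeight k C Z)
    (i : Fin 2) : IsContour (domainI k C) ((2 : ℝ) • profileCurve k C Z i) where
  contDiffOn := (contDiffOn_two_smul_profileCurve hk hC hZ i).of_le one_le_two
  deriv_snd s hs := by
    have ht := (tFun_pos hs).ne'
    rw [deriv_two_smul_profileCurve hk hC hZ i hs, Pi.smul_apply, two_smul_profileCurve]
    simp only [Matrix.cons_val]
    field_simp
    rw [profileSign_sq, mul_one]

theorem normalSpeed_two_smul_profileCurve (hk : k ≠ 0) (hC : 0 < C) (hZ : IsHeight k C Z)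
    (i : Fin 2) (hs : s ∈ domainI k C) :
    normalSpeed (((2 : ℝ) • profileCurve k C Z i) s)
        (deriv ((2 : ℝ) • profileCurve k C Z i) s) =
      profileSign i * ((k - 1) * s ^ 2 + (k + 1)) * hFun k C s * (k ^ 2 - 1) * (s ^ 2 + 1) /
        (8 * k ^ 2 * s ^ 3 * tFun k C s) := by
  have hs0 := hs.1
  have ht := tFun_pos hs
  rw [normalSpeed, deriv_two_smul_profileCurve hk hC hZ i hs, Pi.smul_apply,
    two_smul_profileCurve, (hasDerivAt_tFun hs).deriv, (hasDerivAt_gFun hk hC hs0).deriv, gFun]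
  simp only [Matrix.cons_val]
  field_simp
  rw [Real.sq_sqrt (hFun_pos hC hs0).le]
  ring

theorem meanFactor_two_smul_profileCurve (hk : k ≠ 0) (hC : 0 < C) (hZ : IsHeight k C Z)
    (i : Fin 2) (hs : s ∈ domainI k C) :
    meanFactor (((2 : ℝ) • profileCurve k C Z i) s)
        (deriv ((2 : ℝ) • profileCurve k C Z i) s) =
      profileSign i * ((k - 1) * s ^ 2 + (k + 1)) * hFun k C s * √(hFun k C s) /
        (2 * k * s ^ 2 * tFun k C s) := by
  have hs0 := hs.1
  have ht := tFun_pos hs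
  rw [meanFactor, deriv_two_smul_profileCurve hk hC hZ i hs, Pi.smul_apply,
    two_smul_profileCurve, (hasDerivAt_tFun hs).deriv, (hasDerivAt_gFun hk hC hs0).deriv, gFun]
  simp only [Matrix.cons_val, mul_pow, profileSign_sq, tFun_sq hs]
  field_simp
  ring

theorem hasContourRatio_two_smul_profileCurve {a : ℝ} (hk : k ≠ 0)
    (hka : (1 - k ^ 2) * (1 + a) ^ 2 = 4 * a) (hC : 0 < C) (hZ : IsHeight k C Z) (i : Fin 2)
    (hs : s ∈ domainI k C) (hA : (k - 1) * s ^ 2 + (k + 1) ≠ 0) :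
    HasContourRatio a (((2 : ℝ) • profileCurve k C Z i) s)
      (deriv ((2 : ℝ) • profileCurve k C Z i) s) := by
  have hs0 := hs.1
  have ht := tFun_pos hs
  have hh := hFun_pos (k := k) hC hs0
  have hε : profileSign i ≠ 0 := fun h => by simpa [h] using profileSign_sq i
  rw [HasContourRatio, normalSpeed_two_smul_profileCurve hk hC hZ i hs,
    meanFactor_two_smul_profileCurve hk hC hZ i hs, deriv_two_smul_profileCurve hk hC hZ i hs,
    (hasDerivAt_tFun hs).deriv, Pi.smul_apply, two_smul_profileCurve]
  refine ⟨by positivity, ?_⟩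
  simp only [Matrix.cons_val, mul_pow, profileSign_sq, div_pow, Real.sq_sqrt hh.le]
  field_simp
  simp only [tFun_sq hs, profileSign_sq]
  linear_combination 2 * hFun k C s * hka

theorem isRegularAt_and_hasCurvatureRatioAt_explicitSurface {a p : ℝ} (ha0 : a ≠ 0)
    (hp : p ≠ 0) (hk : k ≠ 0) (hka : (1 - k ^ 2) * (1 + a) ^ 2 = 4 * a) (hC : 0 < C)
    (hZ : IsHeight k C Z) (i : Fin 2) (hs : s ∈ domainI k C)
    (hA : (k - 1) * s ^ 2 + (k + 1) ≠ 0) (v : ℝ) :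
    IsRegularAt (explicitSurface p k C Z i) v s ∧
      HasCurvatureRatioAt (explicitSurface p k C Z i) a v s := by
  have ha : a ≠ -1 := by
    rintro rfl
    norm_num at hka
  have hdom := (isOpen_domainI k C).mem_nhds hs
  have hΓ := isContour_two_smul_profileCurve hk hC hZ i
  have hΓ2 := (contDiffOn_two_smul_profileCurve hk hC hZ i).contDiffAt hdom
  have hratio := hasContourRatio_two_smul_profileCurve hk hka hC hZ i hs hA
  have hρ : normalSpeed (((2 : ℝ) • profileCurve k C Z i) s)
      (deriv ((2 : ℝ) • profileCurve k C Z i) s) ≠ 0 := fun h0 =>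
    mul_ne_zero ha0 (pow_ne_zero 2 hratio.1) (by rw [← hratio.2, h0, mul_zero, mul_zero, neg_zero])
  have hreg : IsRegularAt (helicalSurface 1 ((2 : ℝ) • profileCurve k C Z i)) v s := by
    rw [isRegularAt_helicalSurface_iff (hΓ2.differentiableAt two_ne_zero),
      profileNormal_contour (hΓ.deriv_snd s hs), smul_ne_zero_iff_right hρ]
    exact fun h0 => one_ne_zero (congrArg (· 1) h0)
  rw [explicitSurface_eq_smul]
  refine ⟨(isRegularAt_smul_iff hp).2 hreg, (hasCurvatureRatioAt_smul_iff ha hp hreg).2 ?_⟩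
  exact (hasCurvatureRatioAt_iff_hasContourRatio ha hΓ2
    (Eventually.of_forall fun x => (helicalMotion_zero 1 _).symm) contDiffAt_const
    (hΓ2.of_le one_le_two) (eventually_of_mem hdom hΓ.deriv_snd) hρ v).2 hratio

end ExplicitContour

section ContourParam

variable {a k : ℝ} {J : Set ℝ} {Γ : ℝ → E3} {s : ℝ → ℝ} {u : ℝ}

theorem conic_parametrization {δ η s : ℝ} (hk : 0 < k) (hδ : 0 < δ)
    (h : (k ^ 2 - 1) * δ ^ 2 = 4 * (1 + η * δ + η ^ 2)) (hs : s = ((k + 1) * δ + 2 * η) / 2) :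
    0 < s ∧ k * δ * s = s ^ 2 + 1 ∧ slopeFun k s = η := by
  have hprod : s * (k * δ - s) = 1 := by
    rw [hs]
    linear_combination h / 4
  have hsum : k * δ * s = s ^ 2 + 1 := by linear_combination hprod
  have hs0 : 0 < s := pos_of_mul_pos_right (hsum ▸ by positivity) (mul_pos hk hδ).le
  refine ⟨hs0, hsum, (div_eq_iff (by positivity)).2 ?_⟩
  linear_combination (k + 1) * hsum + 2 * k * s * hs

/-- The quotient `y / √(1 + x²)` at a point of a contour. On the explicit contours it is the
function `slopeFun` of the parameter. -/
def contourSlope (P : E3) : ℝ := P 1 / √(1 + P 0 ^ 2)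

/-- The second coordinate, besides `contourSlope`, in which the condition `HasContourRatio` becomes
the equation of a conic. -/
def contourScale (P Q : E3) : ℝ := meanFactor P Q / (Q 0 * √(1 + P 0 ^ 2))

theorem HasContourRatio.conic {P Q : E3} (h : HasContourRatio a P Q)
    (hka : (1 - k ^ 2) * (1 + a) ^ 2 = 4 * a) (hQ : Q 0 ≠ 0) :
    (k ^ 2 - 1) * contourScale P Q ^ 2 =
      4 * (1 + contourSlope P * contourScale P Q + contourSlope P ^ 2) := by
  have ha : (1 + a) ^ 2 ≠ 0 := by
    intro ha
    have : a = -1 := by linear_combination pow_eq_zero_iff two_ne_zero |>.1 ha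
    norm_num [this] at hka
  have hw : √(1 + P 0 ^ 2) ≠ 0 := by positivity
  have hw2 : √(1 + P 0 ^ 2) ^ 2 = 1 + P 0 ^ 2 := Real.sq_sqrt (by positivity)
  have hm : meanFactor P Q ^ 2 * (k ^ 2 - 1) = 4 * ((1 + P 0 ^ 2) * Q 0 * normalSpeed P Q) :=
    mul_left_cancel₀ ha (by linear_combination -meanFactor P Q ^ 2 * hka + 4 * h.2)
  rw [contourScale, contourSlope]
  field_simp
  rw [normalSpeed] at hm
  rw [hw2]
  simp only [meanFactor] at hm ⊢
  linear_combination hm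

/-- A contour whose slope is the function `slopeFun k` of the parameter `s`, together with the
differential equation that constant ratio of the principal curvatures imposes on the slope. -/
structure IsContourParam (k : ℝ) (J : Set ℝ) (Γ : ℝ → E3) (s : ℝ → ℝ) : Prop
    extends IsContour J Γ where
  continuousOn : ContinuousOn s J
  pos : ∀ u ∈ J, 0 < s u
  slopeFun_eq : ∀ u ∈ J, slopeFun k (s u) = contourSlope (Γ u)
  deriv_fst_ne_zero : ∀ u ∈ J, deriv Γ u 0 ≠ 0
  hasDerivAt_contourSlope : ∀ u ∈ J, HasDerivAt (fun u => contourSlope (Γ u))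
    (Γ u 0 * deriv Γ u 0 * (s u ^ 2 + 1) / (k * s u * (1 + Γ u 0 ^ 2))) u

theorem IsContour.contDiffOn_contourSlope (hΓ : IsContour J Γ) :
    ContDiffOn ℝ 1 (fun u => contourSlope (Γ u)) J := by
  have h := contDiffOn_euclidean.1 hΓ.contDiffOn
  exact (h 1).div ((contDiffOn_const.add ((h 0).pow 2)).sqrt fun u _ => by positivity)
    fun u _ => by positivity

theorem IsContour.hasDerivAt_contourSlope (hΓ : IsContour J Γ) (hJ : IsOpen J) (hu : u ∈ J) :
    HasDerivAt (fun u => contourSlope (Γ u))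
      (Γ u 0 * meanFactor (Γ u) (deriv Γ u) / √(1 + Γ u 0 ^ 2) ^ 3) u := by
  have hw : 0 < 1 + Γ u 0 ^ 2 := by positivity
  have hw2 : √(1 + Γ u 0 ^ 2) ^ 2 = 1 + Γ u 0 ^ 2 := Real.sq_sqrt hw.le
  refine ((hΓ.hasDerivAt_apply hJ hu 1).div ((((hΓ.hasDerivAt_apply hJ hu 0).pow 2).const_add
    1).sqrt hw.ne') (by positivity)).congr_deriv ?_
  rw [hΓ.deriv_snd u hu, meanFactor, ← hw2, Pi.pow_apply]
  simp only [Nat.cast_ofNat, Nat.reduceSub, pow_one, Real.sqrt_sq (Real.sqrt_nonneg _)]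
  field_simp

theorem contourScale_pos {P Q : E3} (h : 0 < meanFactor P Q * Q 0) : 0 < contourScale P Q := by
  rw [contourScale, ← div_div]
  exact div_pos (div_pos_iff.2 (mul_pos_iff.1 h)) (by positivity)

theorem IsCRPCContour.exists_isContourParam (hΓ : IsCRPCContour a J Γ) (hJ : IsOpen J)
    (hk : 0 < k) (hka : (1 - k ^ 2) * (1 + a) ^ 2 = 4 * a) : ∃ s, IsContourParam k J Γ s := by
  set δ : ℝ → ℝ := fun u => contourScale (Γ u) (deriv Γ u)
  set s : ℝ → ℝ := fun u => ((k + 1) * δ u + 2 * contourSlope (Γ u)) / 2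
  have hQ : ∀ u ∈ J, deriv Γ u 0 ≠ 0 := fun u hu => right_ne_zero_of_mul (hΓ.pos u hu).ne'
  have hspec : ∀ u ∈ J, 0 < s u ∧ k * δ u * s u = s u ^ 2 + 1 ∧
      slopeFun k (s u) = contourSlope (Γ u) := fun u hu =>
    conic_parametrization hk (contourScale_pos (hΓ.pos u hu))
      ((hΓ.hasContourRatio u hu).conic hka (hQ u hu)) rfl
  have hc := hΓ.contDiffOn.continuousOn
  have hc' := hΓ.continuousOn_deriv hJ
  have hδ : ContinuousOn δ J := (hΓ.continuousOn_meanFactor hJ).div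
    (by fun_prop) fun u hu => mul_ne_zero (hQ u hu) (by positivity)
  refine ⟨s, hΓ.toIsContour, ((continuousOn_const.mul hδ).add (continuousOn_const.mul
    hΓ.contDiffOn_contourSlope.continuousOn)).div_const 2,
    fun u hu => (hspec u hu).1, fun u hu => (hspec u hu).2.2, hQ, fun u hu => ?_⟩
  refine (hΓ.hasDerivAt_contourSlope hJ hu).congr_deriv ?_
  obtain ⟨hs, hsum, -⟩ := hspec u hu
  have hw : 0 < √(1 + Γ u 0 ^ 2) := by positivity
  have hmean : δ u * (deriv Γ u 0 * √(1 + Γ u 0 ^ 2)) = meanFactor (Γ u) (deriv Γ u) :=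
    div_mul_cancel₀ _ (mul_ne_zero (hQ u hu) hw.ne')
  have hw2 : √(1 + Γ u 0 ^ 2) ^ 2 = 1 + Γ u 0 ^ 2 := Real.sq_sqrt (by positivity)
  rw [← hsum, ← hmean]
  nth_rewrite 3 [← hw2]
  field_simp

theorem IsContourParam.crit_ne_zero (hs : IsContourParam k J Γ s) (hk : 0 < k) (hJ : IsOpen J)
    (hu : u ∈ J) (hx : Γ u 0 ≠ 0) : (k - 1) * s u ^ 2 + (k + 1) ≠ 0 := fun hcrit => by
  have hmax : IsLocalMax (fun u => contourSlope (Γ u)) u := by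
    filter_upwards [hJ.mem_nhds hu] with t ht
    rw [← hs.slopeFun_eq u hu, ← hs.slopeFun_eq t ht]
    exact slopeFun_le_of_critical hk hcrit (hs.pos t ht)
  have hsu := hs.pos u hu
  have hQ := hs.deriv_fst_ne_zero u hu
  refine absurd (hmax.hasDerivAt_eq_zero (hs.hasDerivAt_contourSlope u hu)) ?_
  positivity

theorem IsContourParam.contDiffOn_param (hs : IsContourParam k J Γ s) (hk : 0 < k) (hJ : IsOpen J) :
    ContDiffOn ℝ 1 s {u ∈ J | Γ u 0 ≠ 0} := fun u ⟨hu, hx⟩ => by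
  have hJu := hJ.mem_nhds hu
  have hsu := hs.pos u hu
  refine (contDiffAt_of_comp_eventuallyEq one_ne_zero
    ((contDiffOn_slopeFun hk.ne').contDiffAt (Ioi_mem_nhds hsu)) ?_
    (hs.continuousOn.continuousAt hJu) (hs.contDiffOn_contourSlope.contDiffAt hJu)
    (eventually_of_mem hJu hs.slopeFun_eq)).contDiffWithinAt
  have := hs.crit_ne_zero hk hJ hu hx
  rw [(hasDerivAt_slopeFun hk.ne' hsu.ne').deriv]
  positivity

theorem IsContourParam.isOpen_ne (hs : IsContourParam k J Γ s) (hJ : IsOpen J) :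
    IsOpen {u ∈ J | Γ u 0 ≠ 0} :=
  (contDiffOn_euclidean.1 hs.toIsContour.contDiffOn 0).continuousOn.isOpen_inter_preimage hJ
    isOpen_compl_singleton

theorem IsContourParam.hasDerivAt_param (hs : IsContourParam k J Γ s) (hk : 0 < k) (hJ : IsOpen J)
    (hu : u ∈ J) (hx : Γ u 0 ≠ 0) : HasDerivAt s (deriv s u) u :=
  (((hs.contDiffOn_param hk hJ).contDiffAt ((hs.isOpen_ne hJ).mem_nhds ⟨hu, hx⟩)).differentiableAt
    one_ne_zero).hasDerivAt

theorem IsContourParam.deriv_eq (hs : IsContourParam k J Γ s) (hk : 0 < k) (hJ : IsOpen J)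
    (hu : u ∈ J) (hx : Γ u 0 ≠ 0) :
    deriv s u = 2 * s u * (s u ^ 2 + 1) * (Γ u 0 * deriv Γ u 0) /
      (((k - 1) * s u ^ 2 + (k + 1)) * (1 + Γ u 0 ^ 2)) := by
  have hsu := hs.pos u hu
  have hcrit := hs.crit_ne_zero hk hJ hu hx
  have hcomp := ((hasDerivAt_slopeFun hk.ne' hsu.ne').comp u
    (hs.hasDerivAt_param hk hJ hu hx)).congr_of_eventuallyEq
      (eventually_of_mem (hJ.mem_nhds hu) fun x hx => (hs.slopeFun_eq x hx).symm)
  have h := hcomp.unique (hs.hasDerivAt_contourSlope u hu)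
  have hw : 1 + Γ u 0 ^ 2 ≠ 0 := by positivity
  field_simp at h ⊢
  linear_combination h

theorem IsContourParam.injOn (hs : IsContourParam k J Γ s) (hJ : IsOpen J)
    (hJc : J.OrdConnected) : InjOn (fun u => Γ u 0) J :=
  injOn_of_deriv_ne_zero hJc fun u hu =>
    (hs.hasDerivAt_apply hJ hu 0).deriv ▸ hs.deriv_fst_ne_zero u hu

theorem IsContourParam.hasDerivAt_div_hFun (hs : IsContourParam k J Γ s) (hk : 0 < k)
    (hJ : IsOpen J) (hu : u ∈ J) (hx : Γ u 0 ≠ 0) :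
    HasDerivAt (fun u => (1 + Γ u 0 ^ 2) / hFun k 1 (s u)) 0 u := by
  have hsu := hs.pos u hu
  have hh := hFun_pos (k := k) one_pos hsu
  have hcrit := hs.crit_ne_zero hk hJ hu hx
  refine ((((hs.hasDerivAt_apply hJ hu 0).pow 2).const_add 1).div
    ((hasDerivAt_hFun k 1 hsu).comp u (hs.hasDerivAt_param hk hJ hu hx)) hh.ne').congr_deriv
    (div_eq_zero_iff.2 (Or.inl ?_))
  rw [hs.deriv_eq hk hJ hu hx, Function.comp_apply, Pi.pow_apply]
  field_simp
  ring

theorem IsContourParam.exists_hFun_eq (hs : IsContourParam k J Γ s) (hk : 0 < k) (hJ : IsOpen J)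
    (hJc : IsConnected J) : ∃ C, 0 < C ∧ ∀ u ∈ J, hFun k C (s u) = 1 + Γ u 0 ^ 2 := by
  obtain ⟨u₀, hu₀⟩ := hJc.nonempty
  have hord : J.OrdConnected := hJc.isPreconnected.ordConnected
  have hh : ∀ u ∈ J, 0 < hFun k 1 (s u) := fun u hu => hFun_pos one_pos (hs.pos u hu)
  have hcont : ContinuousOn (fun u => (1 + Γ u 0 ^ 2) / hFun k 1 (s u)) J :=
    (continuousOn_const.add ((contDiffOn_euclidean.1 hs.toIsContour.contDiffOn
      0).continuousOn.pow 2)).div ((contDiffOn_hFun k 1 (n := 0)).continuousOn.comp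
      hs.continuousOn hs.pos) fun u hu => (hh u hu).ne'
  have hzero : {u ∈ J | Γ u 0 = 0}.Subsingleton := fun x hx y hy =>
    hs.injOn hJ hord hx.1 hy.1 (hx.2.trans hy.2.symm)
  have hconst : ∀ u ∈ J, (1 + Γ u 0 ^ 2) / hFun k 1 (s u) =
      (1 + Γ u₀ 0 ^ 2) / hFun k 1 (s u₀) := fun u hu =>
    eq_of_hasDerivAt_zero_off_countable hord hzero.countable hcont
      (fun x hx => hs.hasDerivAt_div_hFun hk hJ hx.1 fun h0 => hx.2 ⟨hx.1, h0⟩) hu hu₀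
  refine ⟨(1 + Γ u₀ 0 ^ 2) / hFun k 1 (s u₀), div_pos (by positivity) (hh u₀ hu₀), fun u hu => ?_⟩
  rw [hFun_eq_mul, ← hconst u hu, div_mul_cancel₀ _ (hh u hu).ne']

end ContourParam

section ExplicitRepresentation

variable {k C : ℝ} {J : Set ℝ} {Γ c : ℝ → E3} {s : ℝ → ℝ} {u : ℝ}

/-- The index of the profile curve that passes through the points with first coordinate `x ≠ 0`. -/
def signIndex (x : ℝ) : Fin 2 := if 0 < x then 0 else 1

theorem profileSign_signIndex_mul (x : ℝ) : profileSign (signIndex x) * x = |x| := by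
  rcases lt_or_ge 0 x with h | h
  · simp [signIndex, profileSign, h, abs_of_pos]
  · simp [signIndex, profileSign, h.not_gt, abs_of_nonpos h]

theorem profileSign_signIndex_mul_abs (x : ℝ) : profileSign (signIndex x) * |x| = x := by
  rw [← profileSign_signIndex_mul, ← mul_assoc, ← sq, profileSign_sq, one_mul]

theorem continuousAt_signIndex {x : ℝ} (hx : x ≠ 0) : ContinuousAt signIndex x := by
  rcases lt_or_gt_of_ne hx with h | h
  · refine (continuousAt_const (y := (1 : Fin 2))).congr ?_
    filter_upwards [eventually_lt_nhds h] with y hy using (if_neg hy.not_gt).symm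
  · refine (continuousAt_const (y := (0 : Fin 2))).congr ?_
    filter_upwards [eventually_gt_nhds h] with y hy using (if_pos hy).symm

theorem tFun_eq_abs {x s : ℝ} (h : hFun k C s = 1 + x ^ 2) : tFun k C s = |x| := by
  rw [tFun, h, add_sub_cancel_left, Real.sqrt_sq_eq_abs]

theorem two_mul_gFun {P : E3} {s : ℝ} (h : hFun k C s = 1 + P 0 ^ 2)
    (hslope : slopeFun k s = contourSlope P) : 2 * gFun k C s = P 1 := by
  have hw : √(1 + P 0 ^ 2) ≠ 0 := by positivity
  simp only [gFun_eq, hslope, contourSlope, h]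
  field_simp

theorem mem_domainI {x s : ℝ} (hs : 0 < s) (h : hFun k C s = 1 + x ^ 2) (hx : x ≠ 0) :
    s ∈ domainI k C :=
  ⟨hs, by rw [h]; exact lt_add_of_pos_right 1 (by positivity)⟩

theorem IsContourParam.hasDerivAt_height (hs : IsContourParam k J Γ s) (hk : 0 < k)
    (hJ : IsOpen J) (hC : 0 < C) (hh : ∀ u ∈ J, hFun k C (s u) = 1 + Γ u 0 ^ 2) {Z : ℝ → ℝ}
    (hZ : IsHeight k C Z) {i : Fin 2} (hu : u ∈ J) (hi : 0 < profileSign i * Γ u 0) :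
    HasDerivAt (fun u => Γ u 2 - 2 * (profileSign i * Z (s u))) 0 u := by
  have hx : Γ u 0 ≠ 0 := right_ne_zero_of_mul hi.ne'
  have hε := profileSign_sq i
  have hsu := hs.pos u hu
  have hds := hs.hasDerivAt_param hk hJ hu hx
  have ht : tFun k C (s u) = profileSign i * Γ u 0 := by
    rw [tFun_eq_abs (x := profileSign i * Γ u 0) (by rw [hh u hu, mul_pow, hε, one_mul]),
      abs_of_pos hi]
  have hg : 2 * (deriv (gFun k C) (s u) * deriv s u) = Γ u 0 * deriv Γ u 2 := by
    have hcomp := ((hasDerivAt_gFun hk.ne' hC hsu).differentiableAt.hasDerivAt.comp u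
      hds).const_mul 2
    rw [← hs.deriv_snd u hu]
    exact hcomp.unique ((hs.hasDerivAt_apply hJ hu 1).congr_of_eventuallyEq
      (eventually_of_mem (hJ.mem_nhds hu) fun x hx =>
        two_mul_gFun (hh x hx) (hs.slopeFun_eq x hx)))
  refine ((hs.hasDerivAt_apply hJ hu 2).sub
    ((((hZ _ (mem_domainI hsu (hh u hu) hx)).comp u hds).const_mul _).const_mul 2)).congr_deriv ?_
  have hε0 : profileSign i ≠ 0 := left_ne_zero_of_mul hi.ne'
  rw [ht]
  field_simp
  linear_combination -hg

theorem IsContourParam.exists_height (hs : IsContourParam k J Γ s) (hk : 0 < k) (hJ : IsOpen J)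
    (hJc : J.OrdConnected) (hC : 0 < C) (hh : ∀ u ∈ J, hFun k C (s u) = 1 + Γ u 0 ^ 2)
    (i : Fin 2) :
    ∃ Z, IsHeight k C Z ∧
      ∀ u ∈ J, 0 < profileSign i * Γ u 0 → Γ u 2 = 2 * (profileSign i * Z (s u)) := by
  obtain ⟨Z, hZ⟩ := exists_isHeight hk.ne' hC
  set I : Set ℝ := J ∩ (fun u => Γ u 0) ⁻¹' {x | 0 < profileSign i * x}
  rcases I.eq_empty_or_nonempty with hI | ⟨u₀, hu₀⟩
  · exact ⟨Z, hZ, fun u hu hi => ((hI ▸ ⟨hu, hi⟩ : u ∈ (∅ : Set ℝ))).elim⟩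
  have hIc : I.OrdConnected := ordConnected_inter_preimage hJc
    (convex_halfSpace_gt (LinearMap.mulLeft ℝ (profileSign i)).isLinear 0).ordConnected
    (contDiffOn_euclidean.1 hs.toIsContour.contDiffOn 0).continuousOn (hs.injOn hJ hJc)
  have hderiv : ∀ u ∈ I, HasDerivAt (fun u => Γ u 2 - 2 * (profileSign i * Z (s u))) 0 u :=
    fun u hu => hs.hasDerivAt_height hk hJ hC hh hZ hu.1 hu.2
  set d : ℝ := Γ u₀ 2 - 2 * (profileSign i * Z (s u₀))
  refine ⟨fun t => Z t + profileSign i * d / 2, hZ.add_const _, fun u hu hi => ?_⟩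
  have hconst : Γ u 2 - 2 * (profileSign i * Z (s u)) = d :=
    eq_of_hasDerivAt_zero_off_countable hIc countable_empty
      (fun x hx => (hderiv x hx).continuousAt.continuousWithinAt)
      (fun x hx => hderiv x hx.1) ⟨hu, hi⟩ hu₀
  linear_combination hconst - d * profileSign_sq i

theorem IsContourParam.deriv_ne_zero (hs : IsContourParam k J Γ s) (hk : 0 < k) (hJ : IsOpen J)
    (hu : u ∈ J) (hx : Γ u 0 ≠ 0) : deriv s u ≠ 0 := by
  have hcrit := hs.crit_ne_zero hk hJ hu hx
  have hsu := hs.pos u hu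
  have hQ := hs.deriv_fst_ne_zero u hu
  rw [hs.deriv_eq hk hJ hu hx]
  positivity

theorem IsContourParam.exists_eq_profileCurve (hs : IsContourParam k J Γ s) (hk : 0 < k)
    (hJ : IsOpen J) (hJc : IsConnected J) :
    ∃ C : ℝ, 0 < C ∧ ∃ Z : Fin 2 → ℝ → ℝ, (∀ i, IsHeight k C (Z i)) ∧
      ∀ u ∈ J, Γ u 0 ≠ 0 → s u ∈ domainI k C ∧
        Γ u = (2 : ℝ) • profileCurve k C (Z (signIndex (Γ u 0))) (signIndex (Γ u 0)) (s u) := by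
  obtain ⟨C, hC, hh⟩ := hs.exists_hFun_eq hk hJ hJc
  choose Z hZ hheight using hs.exists_height hk hJ hJc.isPreconnected.ordConnected hC hh
  refine ⟨C, hC, Z, hZ, fun u hu hx => ⟨mem_domainI (hs.pos u hu) (hh u hu) hx, ?_⟩⟩
  rw [two_smul_profileCurve, tFun_eq_abs (hh u hu), profileSign_signIndex_mul_abs,
    two_mul_gFun (hh u hu) (hs.slopeFun_eq u hu),
    ← hheight _ u hu (by rw [profileSign_signIndex_mul]; exact abs_pos.2 hx)]
  ext j
  fin_cases j <;> rfl

theorem axialParams_eq_inv_smul {p : ℝ} (hp : p ≠ 0) (c : ℝ → E3) (J : Set ℝ) :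
    axialParams p c J = axialParams 1 (p⁻¹ • c) J := by
  rw [axialParams, axialParams, helicalSurface_eq_smul hp]
  simp only [tangentPlane_smul hp]

theorem helicalSurface_eq_explicitSurface {p θ t : ℝ} {Z : ℝ → ℝ} {i : Fin 2} (hp : p ≠ 0)
    (h : (p⁻¹ • c) u = helicalMotion 1 θ ((2 : ℝ) • profileCurve k C Z i t)) (v : ℝ) :
    helicalSurface p c v u = explicitSurface p k C Z i (v + θ) t := by
  rw [helicalSurface_eq_smul hp, explicitSurface_eq_smul]
  simp only [Pi.smul_apply, helicalSurface, helicalMotion_add]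
  rw [← h, Pi.smul_apply]

theorem exists_isContourParam_of_helicalSurface {a p : ℝ} (ha0 : a ≠ 0) (hp : p ≠ 0) (hk : 0 < k)
    (hka : (1 - k ^ 2) * (1 + a) ^ 2 = 4 * a) (hJ : IsOpen J) (hJc : J.OrdConnected)
    (hc : ContDiffOn ℝ 2 c J)
    (h : ∀ u ∈ J, IsRegularAt (helicalSurface p c) 0 u ∧
      HasCurvatureRatioAt (helicalSurface p c) a 0 u) :
    ∃ (φ : ℝ → ℝ) (Γ : ℝ → E3) (s : ℝ → ℝ), ContDiffOn ℝ 1 φ J ∧ IsContourParam k J Γ s ∧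
      (∀ u ∈ J, (p⁻¹ • c) u = helicalMotion 1 (φ u) (Γ u)) ∧
      axialParams p c J = {u ∈ J | Γ u 0 = 0} := by
  have ha : a ≠ -1 := by
    rintro rfl
    norm_num at hka
  have hb : ContDiffOn ℝ 2 (p⁻¹ • c) J := contDiffOn_const.smul hc
  have hreg : ∀ u ∈ J, IsRegularAt (helicalSurface 1 (p⁻¹ • c)) 0 u := fun u hu =>
    (isRegularAt_smul_iff hp).1 (helicalSurface_eq_smul hp c ▸ (h u hu).1)
  have hn : ∀ u ∈ J, profileNormal 1 (p⁻¹ • c) u ≠ 0 := fun u hu =>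
    (isRegularAt_helicalSurface_iff
      ((hb.contDiffAt (hJ.mem_nhds hu)).differentiableAt two_ne_zero) 1 0).1 (hreg u hu)
  obtain ⟨φ, Γ, hφ, hΓ, hcΓ⟩ := exists_isCRPCContour ha0 ha hJ hJc hb hn fun u hu =>
    (hasCurvatureRatioAt_smul_iff ha hp (hreg u hu)).1 (helicalSurface_eq_smul hp c ▸ (h u hu).2)
  obtain ⟨s, hs⟩ := hΓ.exists_isContourParam hJ hk hka
  refine ⟨φ, Γ, s, hφ, hs, hcΓ, ?_⟩
  rw [axialParams_eq_inv_smul hp,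
    hΓ.axialParams_eq hJ (hb.of_le one_le_two) hn hφ hcΓ]

end ExplicitRepresentation

end HelicalCRPC

end

theorem theorem3p1 (a p : ℝ) (ha0 : a ≠ 0) (ha1 : a ≠ 1) (ham1 : a ≠ -1) (hp : p ≠ 0) :
    -- every helical surface of pitch `p` with constant ratio `a` is a part of an explicit one
    (∀ (J : Set ℝ) (c : ℝ → HelicalCRPC.E3),
      IsOpen J → IsConnected J → ContDiffOn ℝ 2 c J →
      (∀ v : ℝ, ∀ u ∈ J,
        HelicalCRPC.IsRegularAt (HelicalCRPC.helicalSurface p c) v u ∧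
        HelicalCRPC.HasCurvatureRatioAt (HelicalCRPC.helicalSurface p c) a v u) →
      (HelicalCRPC.axialParams p c J).Subsingleton ∧
      ∃ C : ℝ, 0 < C ∧
      ∃ Z : Fin 2 → ℝ → ℝ,
        (∀ i, HelicalCRPC.IsHeight (HelicalCRPC.ratioParam a) C (Z i)) ∧
      ∃ (i : ℝ → Fin 2) (σ φ : ℝ → ℝ),
        ContinuousOn i (J \ HelicalCRPC.axialParams p c J) ∧
        ContDiffOn ℝ 1 σ (J \ HelicalCRPC.axialParams p c J) ∧
        ContDiffOn ℝ 1 φ (J \ HelicalCRPC.axialParams p c J) ∧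
        ∀ u ∈ J \ HelicalCRPC.axialParams p c J,
          σ u ∈ HelicalCRPC.domainI (HelicalCRPC.ratioParam a) C ∧
          deriv σ u ≠ 0 ∧
          ∀ v : ℝ, HelicalCRPC.helicalSurface p c v u =
            HelicalCRPC.explicitSurface p (HelicalCRPC.ratioParam a) C (Z (i u)) (i u)
              (v + φ u) (σ u)) ∧
    -- the explicit surfaces, off their singular helix, have constant ratio `a`
    (∀ (C : ℝ) (Z : ℝ → ℝ) (i : Fin 2), 0 < C →
      HelicalCRPC.IsHeight (HelicalCRPC.ratioParam a) C Z →
      ∀ v : ℝ, ∀ s ∈ HelicalCRPC.domainI (HelicalCRPC.ratioParam a) C,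
        (HelicalCRPC.ratioParam a - 1) * s ^ 2 + (HelicalCRPC.ratioParam a + 1) ≠ 0 →
        HelicalCRPC.IsRegularAt
          (HelicalCRPC.explicitSurface p (HelicalCRPC.ratioParam a) C Z i) v s ∧
        HelicalCRPC.HasCurvatureRatioAt
          (HelicalCRPC.explicitSurface p (HelicalCRPC.ratioParam a) C Z i) a v s) := by
  have hk := HelicalCRPC.ratioParam_pos ha1 ham1
  have hka := HelicalCRPC.ratioParam_sq ham1
  refine ⟨fun J c hJ hJc hc h => ?_, fun C Z i hC hZ v s hs hA =>
    HelicalCRPC.isRegularAt_and_hasCurvatureRatioAt_explicitSurface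
      ha0 hp hk.ne' hka hC hZ i hs hA v⟩
  have hord := hJc.isPreconnected.ordConnected
  obtain ⟨φ, Γ, s, hφ, hs, hcΓ, hax⟩ :=
    HelicalCRPC.exists_isContourParam_of_helicalSurface ha0 hp hk hka hJ hord hc (h 0)
  obtain ⟨C, hC, Z, hZ, hexplicit⟩ := hs.exists_eq_profileCurve hk hJ hJc
  have hdiff : J \ HelicalCRPC.axialParams p c J = {u ∈ J | Γ u 0 ≠ 0} := by
    rw [hax]
    exact Set.sdiff_self_inter
  rw [hdiff]
  refine ⟨?_, C, hC, Z, hZ, fun u => HelicalCRPC.signIndex (Γ u 0), s, φ, fun u hu => ?_,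
    hs.contDiffOn_param hk hJ, hφ.mono fun u hu => hu.1, fun u hu =>
      ⟨(hexplicit u hu.1 hu.2).1, hs.deriv_ne_zero hk hJ hu.1 hu.2, ?_⟩⟩
  · rw [hax]
    exact fun x hx y hy => hs.injOn hJ hord hx.1 hy.1 (hx.2.trans hy.2.symm)
  · exact (ContinuousAt.comp (f := fun u => Γ u 0) (HelicalCRPC.continuousAt_signIndex hu.2)
      (hs.hasDerivAt_apply hJ hu.1 0).continuousAt).continuousWithinAt
  · refine HelicalCRPC.helicalSurface_eq_explicitSurface hp ?_
    rw [hcΓ u hu.1, ← (hexplicit u hu.1 hu.2).2]
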